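/- Fix an integer $n\ge 1$. Let $\overline{\mathrm{Cvx}}_0(\mathbb R^n)$ be the set of lower semicontinuous convex functions $\varphi:\mathbb R^n\to[0,\infty]$ with $\varphi(0)=0$ and $0<\int_{\mathbb R^n}e^{-\varphi}<\infty$. For such $\varphi$ let $$(\mathcal L\varphi)(y)=\sup_{x}\bigl(\langle x,y\rangle-\varphi(x)\bigr),\qquad (\mathcal A\varphi)(y)=\sup_{x}\frac{\langle x,y\rangle-1}{\varphi(x)},\qquad \mathcal J=\mathcal A\mathcal L$$ (in $\mathcal A$, a term with $\langle x,y\rangle>1$ and $\varphi(x)=0$ equals $+\infty$, a term with $\varphi(x)=\infty$ equals $0$, and terms with $\langle x,y\rangle\le 1$ count as $0$), and for $\alpha>0$ let $$\mathcal J^l_\alpha=\alpha\mathcal J,\qquad \mathcal R_{\mathcal J^l_\alpha}(\varphi)=\frac{\int_{\mathbb R^n} e^{-\mathcal J^l_\alpha\varphi}}{\int_{\mathbb R^n} e^{-\varphi}}.$$ A convex body is a compact convex set with non-empty interior. For a convex body $K$ containing the origin let $\|x\|_K=\inf\{r>0:x\in rK\}$ (with $\inf\emptyset=+\infty$), and let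 $1^\infty_K$ be $0$ on $K$ and $+\infty$ outside $K$. **Theorem.** There is a unique real number $\rho_n\in(0,\frac14)$ with $$\left(1-\sqrt{1-4\rho_n}\right)(4\rho_n)^{-\frac1{n+2}}e^{\sqrt{1-4\rho_n}}=\left(\frac{2\sqrt[n]{n!}}{n+2}\right)^{\frac n{n+2}}.$$ For every $\alpha\in[\rho_n(n+2)^2,\infty)$ and every $\varphi\in\overline{\mathrm{Cvx}}_0(\mathbb R^n)$ the following hold. 1. $\mathcal R_{\mathcal J^l_\alpha}(\varphi)\le\frac1{n!}$, with equality if and only if $\varphi=\|\cdot\|_K$ for some convex body $K$ containing the origin. 2. $\mathcal R_{\mathcal J^l_\alpha}(\varphi)\ge\frac{n!}{\alpha^n}$, with equality if and only if $\varphi=\mathcal J\|\cdot\|_K=1^\infty_K$ for some convex body $K$ containing the origin. If moreover the origin is an interior point of $\{\varphi<\infty\}$, then both equivalences also hold with "containing the origin in its interior" in place of "containing the origin". -/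

import Mathlib

open scoped NNReal ENNReal Pointwise

noncomputable section

namespace ScaledGauge

variable {n : ℕ}

/-- The space `ℝⁿ` with the standard inner product and Lebesgue measure. -/
abbrev Sp (n : ℕ) : Type := EuclideanSpace ℝ (Fin n)

/-- Geometric convex functions: lower semicontinuous convex functions `ℝⁿ → [0,∞]` vanishing at the
origin (convexity with values in `[0,∞]`, where `0 * ∞ = 0`). -/
structure IsGeometricConvex (φ : Sp n → ℝ≥0∞) : Prop where
  lsc : LowerSemicontinuous φ
  convex : ConvexOn ℝ≥0 Set.univ φ
  map_zero : φ 0 = 0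

/-- The integral `∫ e^{-φ}` over `ℝⁿ`, with `e^{-∞} = 0`. -/
def expIntegral (φ : Sp n → ℝ≥0∞) : ℝ≥0∞ :=
  ∫⁻ x, EReal.exp (-(φ x : EReal))

/-- Geometric convex functions with `0 < ∫ e^{-φ} < ∞`. -/
structure IsGeometricConvexIntegrable (φ : Sp n → ℝ≥0∞) : Prop where
  geometric : IsGeometricConvex φ
  integral_pos : 0 < expIntegral φ
  integral_lt_top : expIntegral φ < ⊤

/-- The Legendre transform `(Lφ)(y) = sup_x (⟨x, y⟩ - φ x)`. For `φ ≥ 0` with `φ 0 = 0` the supremum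
is nonnegative, so that truncating each term at `0` does not change it. -/
def legendre (φ : Sp n → ℝ≥0∞) (y : Sp n) : ℝ≥0∞ :=
  ⨆ x : Sp n, ENNReal.ofReal (inner ℝ x y) - φ x

/-- The polarity transform `(Aφ)(y) = sup_x (⟨x, y⟩ - 1) / φ x`, with the usual conventions: a term
with `⟨x, y⟩ > 1` and `φ x = 0` is `∞`, a term with `φ x = ∞` is `0`, and terms with `⟨x, y⟩ ≤ 1` do
not matter (the transform is nonnegative), so they count as `0`. -/
def polarity (φ : Sp n → ℝ≥0∞) (y : Sp n) : ℝ≥0∞ :=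
  ⨆ x : Sp n, ENNReal.ofReal (inner ℝ x y - 1) / φ x

/-- The gauge transform `J = A L`. -/
def gaugeTransform (φ : Sp n → ℝ≥0∞) : Sp n → ℝ≥0∞ :=
  polarity (legendre φ)

/-- The scaled polarity transform `A_α = α A`. -/
def scaledPolarity (α : ℝ) (φ : Sp n → ℝ≥0∞) (y : Sp n) : ℝ≥0∞ :=
  ENNReal.ofReal α * polarity φ y

/-- The scaled gauge transform `J_α^l = A_α L = α J`. -/
def scaledGaugeTransform (α : ℝ) (φ : Sp n → ℝ≥0∞) : Sp n → ℝ≥0∞ :=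
  scaledPolarity α (legendre φ)

/-- The Santaló ratio `∫ e^{-J_α^l φ} / ∫ e^{-φ}`. -/
def santaloRatio (α : ℝ) (φ : Sp n → ℝ≥0∞) : ℝ≥0∞ :=
  expIntegral (scaledGaugeTransform α φ) / expIntegral φ

/-- Convex bodies (compact convex sets with nonempty interior) that contain the origin, possibly as
a boundary point. -/
structure IsBodyWithOrigin (K : Set (Sp n)) : Prop where
  compact : IsCompact K
  convex : Convex ℝ K
  interior_nonempty : (interior K).Nonempty
  zero_mem : (0 : Sp n) ∈ K

/-- Convex bodies that contain the origin in their interior. -/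
structure IsBodyWithInteriorOrigin (K : Set (Sp n)) : Prop where
  compact : IsCompact K
  convex : Convex ℝ K
  zero_mem_interior : (0 : Sp n) ∈ interior K

/-- The Minkowski functional `‖x‖_K = inf {r > 0 : x ∈ r K}`, equal to `∞` if there is no such `r`
(Mathlib's real-valued `gauge` would be `0` there). -/
def minkowski (K : Set (Sp n)) (x : Sp n) : ℝ≥0∞ :=
  ⨅ (r : ℝ) (_ : 0 < r ∧ x ∈ r • K), ENNReal.ofReal r

open Classical in
/-- The convex indicator function `1_K^∞`: `0` on `K` and `∞` outside `K`. -/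
def convexIndicator (K : Set (Sp n)) (x : Sp n) : ℝ≥0∞ :=
  if x ∈ K then 0 else ⊤

/-- `ρ` lies in `(0, 1/4)` and satisfies
`(1 - √(1 - 4ρ)) (4ρ)^{-1/(n+2)} e^{√(1 - 4ρ)} = (2 (n!)^{1/n} / (n+2))^{n/(n+2)}`. -/
def IsRho (n : ℕ) (ρ : ℝ) : Prop :=
  ρ ∈ Set.Ioo (0 : ℝ) (1 / 4) ∧
    (1 - √(1 - 4 * ρ)) * (4 * ρ) ^ (-(1 / ((n : ℝ) + 2))) * Real.exp (√(1 - 4 * ρ)) =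
      (2 * (n.factorial : ℝ) ^ (1 / (n : ℝ)) / ((n : ℝ) + 2)) ^ ((n : ℝ) / ((n : ℝ) + 2))

end ScaledGauge

end

noncomputable section

namespace ScaledGauge

open Set MeasureTheory Filter Topology

/-! Both bounds are one inequality between two probability laws on the half-line. By Fenchel–Moreau,
`{Jφ ≤ s} = s {φ ≤ 1/s}`, hence `{αJφ ≤ s} = (s/α) {φ ≤ α/s}`. With `g t = |t⁻¹ {φ ≤ t}|`, the
layer-cake formula gives `∫ e^{-φ} = ∫ e^{-t} tⁿ g(t) dt` and `∫ e^{-αJφ} = ∫ e^{-s} g(α/s) ds`.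
Convexity and `φ 0 = 0` make `g` antitone. The upper bound is thus `domination`: for antitone `g`,
`n! ∫ e^{-s} g(α/s) ds ≤ ∫ e^{-t} tⁿ g(t) dt`. The lower bound is the same inequality for the
antitone function `s ↦ |{φ ≤ α/s}|`, with the roles of the two integrals exchanged.

For the domination, substitute `s = α/t`. The densities `p = e^{-t} tⁿ` and `q = n! α t⁻² e^{-α/t}`
have equal mass `n!`. At `α = ρ(n+2)²` the function `log (p/q)` decreases, increases, then
decreases, and the equation for `ρ` says exactly that its local minimum value is `0`. So `p - q`
changes sign once, from plus to minus at some `t₀`, and integrating `(p - q)(g - g t₀) ≥ 0` gives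
the claim. A larger `α` only decreases `g(α/s)`.

Equality forces `g` to be constant. Nested convex sets of equal finite positive volume (the smaller
one closed) coincide, so either `t⁻¹ {φ ≤ t}` or `{φ ≤ t}` does not depend on `t`: `φ` is a gauge or
an indicator. -/

/-! ### The equation for `ρ` -/

/-- The `(n + 2)`-nd power of the left-hand side of the equation defining `ρ`, as a function of
`u = √(1 - 4ρ)`. -/
def rhoProfile (n : ℕ) (u : ℝ) : ℝ :=
  (1 - u) ^ (n + 1) * Real.exp (((n : ℝ) + 2) * u) / (1 + u)

/-- Places the right-hand side of the equation for `ρ` below `rhoProfile n 0 = 1`. The induction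
step is Bernoulli's inequality for `(1 + 1/(n+2))^(n+1)`. -/
lemma two_pow_mul_factorial_lt (n : ℕ) (hn : 1 ≤ n) :
    (2 : ℝ) ^ n * n.factorial < ((n : ℝ) + 2) ^ n := by
  induction n, hn using Nat.le_induction with
  | base => norm_num
  | succ n hn ih =>
    have hb : 1 + ((n + 1 : ℕ) : ℝ) * (1 / ((n : ℝ) + 2)) ≤ (1 + 1 / ((n : ℝ) + 2)) ^ (n + 1) :=
      one_add_mul_le_pow (by have : (0 : ℝ) ≤ 1 / ((n : ℝ) + 2) := by positivity
                             linarith) _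
    have h1 : (((n + 1 : ℕ) : ℝ) + 2) ^ (n + 1) =
        (1 + 1 / ((n : ℝ) + 2)) ^ (n + 1) * ((n : ℝ) + 2) ^ (n + 1) := by
      rw [← mul_pow]; congr 1; push_cast; field_simp; ring
    have h2 : (1 + ((n + 1 : ℕ) : ℝ) * (1 / ((n : ℝ) + 2))) * ((n : ℝ) + 2) ^ (n + 1) =
        (2 * n + 3) * ((n : ℝ) + 2) ^ n := by
      push_cast; rw [pow_succ]; field_simp; ring
    have h3 : (2 * n + 3) * ((n : ℝ) + 2) ^ n ≤ (((n + 1 : ℕ) : ℝ) + 2) ^ (n + 1) := by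
      rw [h1, ← h2]; gcongr
    refine lt_of_lt_of_le ?_ h3
    rw [Nat.factorial_succ, pow_succ]
    push_cast
    have h4 : (2 : ℝ) * (n + 1) * (2 ^ n * n.factorial) < 2 * (n + 1) * ((n : ℝ) + 2) ^ n := by
      gcongr
    have h5 : (0 : ℝ) < ((n : ℝ) + 2) ^ n := by positivity
    nlinarith

lemma hasDerivAt_rhoProfile (n : ℕ) {u : ℝ} (hu : 0 ≤ u) :
    HasDerivAt (rhoProfile n)
      (-(u * (1 - u) ^ n * Real.exp (((n : ℝ) + 2) * u) * (n + (n + 2) * u) / (1 + u) ^ 2)) u := by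
  have h1 : HasDerivAt (fun u : ℝ => (1 - u) ^ (n + 1)) (((n + 1 : ℕ) : ℝ) * (1 - u) ^ n * (-1)) u := by
    simpa using ((hasDerivAt_id u).const_sub 1).fun_pow (n + 1)
  have h2 : HasDerivAt (fun u : ℝ => Real.exp (((n : ℝ) + 2) * u))
      (Real.exp (((n : ℝ) + 2) * u) * ((n : ℝ) + 2)) u := by
    simpa using ((hasDerivAt_id u).const_mul ((n : ℝ) + 2)).exp
  have h3 : HasDerivAt (fun u : ℝ => 1 + u) 1 u := (hasDerivAt_id u).const_add 1
  have h := (h1.mul h2).div h3 (by positivity)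
  refine HasDerivAt.congr_deriv (f := rhoProfile n) h ?_
  have : (1 + u) ≠ 0 := by positivity
  simp only [Pi.mul_apply]
  push_cast
  field_simp
  ring

lemma strictAntiOn_rhoProfile (n : ℕ) (hn : 1 ≤ n) : StrictAntiOn (rhoProfile n) (Icc 0 1) := by
  refine strictAntiOn_of_deriv_neg (convex_Icc 0 1)
    (fun u hu => (hasDerivAt_rhoProfile n hu.1).continuousAt.continuousWithinAt) ?_
  intro u hu
  rw [interior_Icc] at hu
  rw [(hasDerivAt_rhoProfile n hu.1.le).deriv, neg_lt_zero]
  have h0 := hu.1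
  have h1 : 0 < 1 - u := by linarith [hu.2]
  positivity

/-- Both sides of the defining equation are nonnegative, so they may be raised to the power `n + 2`;
then `4ρ = (1 - u)(1 + u)` cancels one factor `1 - u`. -/
lemma isRho_iff (n : ℕ) (hn : 1 ≤ n) (ρ : ℝ) :
    IsRho n ρ ↔ ρ ∈ Ioo (0 : ℝ) (1 / 4) ∧
      rhoProfile n (√(1 - 4 * ρ)) = 2 ^ n * n.factorial / ((n : ℝ) + 2) ^ n := by
  refine and_congr_right fun hρ => ?_
  set u := √(1 - 4 * ρ) with hu
  have hu2 : u ^ 2 = 1 - 4 * ρ := Real.sq_sqrt (by linarith [hρ.2])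
  have hu0 : 0 ≤ u := Real.sqrt_nonneg _
  have hu1 : u < 1 := by nlinarith [hρ.1]
  have hρ4 : (0 : ℝ) < 4 * ρ := by linarith [hρ.1]
  have h1u : 0 < 1 - u := by linarith
  have hn0 : (n : ℝ) ≠ 0 := by positivity
  rw [← pow_left_inj₀ (n := n + 2) (by positivity) (by positivity) (by omega)]
  have e1 : ((4 * ρ) ^ (-(1 / ((n : ℝ) + 2)))) ^ (n + 2) = (4 * ρ)⁻¹ := by
    rw [← Real.rpow_natCast, ← Real.rpow_mul hρ4.le, ← Real.rpow_neg_one]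
    congr 1
    push_cast
    field_simp
  have e2 : ((2 * (n.factorial : ℝ) ^ (1 / (n : ℝ)) / ((n : ℝ) + 2)) ^ ((n : ℝ) / ((n : ℝ) + 2))) ^
      (n + 2) = 2 ^ n * n.factorial / ((n : ℝ) + 2) ^ n := by
    rw [← Real.rpow_natCast, ← Real.rpow_mul (by positivity)]
    have : (n : ℝ) / ((n : ℝ) + 2) * ((n + 2 : ℕ) : ℝ) = (n : ℕ) := by push_cast; field_simp
    rw [this, Real.rpow_natCast, div_pow, mul_pow, ← Real.rpow_natCast ((n.factorial : ℝ) ^ _),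
      ← Real.rpow_mul (by positivity), one_div_mul_cancel hn0, Real.rpow_one]
  have e3 : ((1 - u) * (4 * ρ) ^ (-(1 / ((n : ℝ) + 2))) * Real.exp u) ^ (n + 2) =
      rhoProfile n u := by
    rw [mul_pow, mul_pow, e1, ← Real.exp_nat_mul, rhoProfile]
    have : 4 * ρ = (1 - u) * (1 + u) := by linarith
    rw [this, pow_succ (1 - u) (n + 1)]
    push_cast
    field_simp
  rw [e2, e3]

theorem existsUnique_isRho (n : ℕ) (hn : 1 ≤ n) : ∃! ρ : ℝ, IsRho n ρ := by
  have hc : ContinuousOn (rhoProfile n) (Icc 0 1) :=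
    fun u hu => (hasDerivAt_rhoProfile n hu.1).continuousAt.continuousWithinAt
  have hf : (0 : ℝ) < n.factorial := by positivity
  have hlt := two_pow_mul_factorial_lt n hn
  have hv : (2 ^ n * n.factorial / ((n : ℝ) + 2) ^ n : ℝ) ∈
      Ioo (rhoProfile n 1) (rhoProfile n 0) := by
    constructor
    · simp only [rhoProfile, sub_self, zero_pow (Nat.succ_ne_zero n), zero_mul, zero_div]
      positivity
    · simp only [rhoProfile, sub_zero, one_pow, mul_zero, Real.exp_zero, add_zero, mul_one, div_one]
      rw [div_lt_one (by positivity)]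
      exact hlt
  obtain ⟨u, hu, huv⟩ := intermediate_value_Ioo' zero_le_one hc hv
  refine ⟨(1 - u ^ 2) / 4, ?_, ?_⟩
  · refine (isRho_iff n hn _).2 ⟨⟨?_, ?_⟩, ?_⟩
    · nlinarith [hu.1, hu.2]
    · nlinarith [hu.1, hu.2]
    · have : 1 - 4 * ((1 - u ^ 2) / 4) = u ^ 2 := by ring
      rw [this, Real.sqrt_sq hu.1.le, huv]
  · intro ρ hρ
    obtain ⟨hρ1, hρ2⟩ := (isRho_iff n hn _).1 hρ
    have h0 : 0 ≤ √(1 - 4 * ρ) := Real.sqrt_nonneg _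
    have h2 : √(1 - 4 * ρ) ^ 2 = 1 - 4 * ρ := Real.sq_sqrt (by linarith [hρ1.2])
    have := (strictAntiOn_rhoProfile n hn).injOn ⟨h0, by nlinarith [hρ1.1]⟩
      (Ioo_subset_Icc_self hu) (hρ2.trans huv.symm)
    rw [this] at h2
    linarith

/-! ### Single crossing of the two densities -/

/-- The logarithm of the ratio of `e^{-t} tⁿ` and `n! α t⁻² e^{-α/t}`. -/
def logDensityRatio (n : ℕ) (α t : ℝ) : ℝ :=
  ((n : ℝ) + 2) * Real.log t - t + α / t - Real.log (n.factorial * α)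

lemma density_mul_exp_logDensityRatio (n : ℕ) {α t : ℝ} (hα : 0 < α) (ht : 0 < t) :
    n.factorial * (α / t ^ 2 * Real.exp (-(α / t))) * Real.exp (logDensityRatio n α t) =
      Real.exp (-t) * t ^ n := by
  have h1 : Real.exp (((n : ℝ) + 2) * Real.log t) = t ^ (n + 2) := by
    rw [mul_comm, ← Real.rpow_def_of_pos ht]
    exact_mod_cast Real.rpow_natCast t (n + 2)
  have hf : (0 : ℝ) < n.factorial := by positivity
  rw [logDensityRatio, Real.exp_sub, Real.exp_add, Real.exp_sub, h1, Real.exp_log (by positivity),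
    Real.exp_neg, Real.exp_neg]
  field_simp
  ring

/-- The critical points are the roots of `t² - (n+2)t + α`; writing `α = ab` with `a + b = n + 2`
makes the sign of the derivative visible. -/
lemma hasDerivAt_logDensityRatio (n : ℕ) {a b t : ℝ} (hab : a + b = n + 2) (ht : 0 < t) :
    HasDerivAt (logDensityRatio n (a * b)) (-((t - a) * (t - b)) / t ^ 2) t := by
  have h1 := ((Real.hasDerivAt_log ht.ne').const_mul ((n : ℝ) + 2)).sub (hasDerivAt_id t)
  have h2 := (hasDerivAt_const t (a * b)).div (hasDerivAt_id t) ht.ne'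
  refine HasDerivAt.congr_deriv (f := logDensityRatio n (a * b))
    ((h1.add h2).sub_const (Real.log (n.factorial * (a * b)))) ?_
  simp only [id]
  field_simp
  rw [← hab]
  ring

/-- At the critical parameter the densities `e^{-t} tⁿ` and `n! α t⁻² e^{-α/t}` are ordered one way
before some `t₀` (apart from a point of tangency) and the other way after it. -/
theorem exists_density_crossing (n : ℕ) (hn : 1 ≤ n) {ρ : ℝ} (hρ : IsRho n ρ) {α : ℝ}
    (hα : α = ρ * ((n : ℝ) + 2) ^ 2) :
    ∃ a t₀ : ℝ, 0 < t₀ ∧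
      (∀ t, 0 < t → t < t₀ → t ≠ a →
        n.factorial * (α / t ^ 2 * Real.exp (-(α / t))) < Real.exp (-t) * t ^ n) ∧
      (∀ t, t₀ < t →
        Real.exp (-t) * t ^ n < n.factorial * (α / t ^ 2 * Real.exp (-(α / t)))) := by
  obtain ⟨hρ1, hρ2⟩ := (isRho_iff n hn _).1 hρ
  set u := √(1 - 4 * ρ) with hu
  have hu2 : u ^ 2 = 1 - 4 * ρ := Real.sq_sqrt (by linarith [hρ1.2])
  have hu0 : 0 < u := Real.sqrt_pos.2 (by linarith [hρ1.2])
  have hu1 : u < 1 := by nlinarith [hρ1.1]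
  have h1u : 0 < 1 - u := by linarith
  set a := ((n : ℝ) + 2) * (1 - u) / 2 with ha
  set b := ((n : ℝ) + 2) * (1 + u) / 2 with hb
  have hab : a + b = n + 2 := by rw [ha, hb]; ring
  have ha0 : 0 < a := by positivity
  have hlt : a < b := by rw [ha, hb]; gcongr; linarith
  have hb0 : 0 < b := ha0.trans hlt
  have hαab : α = a * b := by
    rw [hα, ha, hb]
    have : ρ = (1 - u ^ 2) / 4 := by linarith
    rw [this]; ring
  have hα0 : 0 < α := hαab ▸ mul_pos ha0 hb0
  have hf : (0 : ℝ) < n.factorial := by positivity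
  have hcont : ∀ t, 0 < t → ContinuousAt (logDensityRatio n α) t := fun t ht => by
    rw [hαab]; exact (hasDerivAt_logDensityRatio n hab ht).continuousAt
  have hderiv : ∀ t, 0 < t → deriv (logDensityRatio n α) t = -((t - a) * (t - b)) / t ^ 2 :=
    fun t ht => by rw [hαab]; exact (hasDerivAt_logDensityRatio n hab ht).deriv
  -- The only use of the exact value of `ρ`: multiplied out, its equation reads `n! b = a^(n+1)
  -- e^{(n+2)u}`, and `b - a = (n+2)u`.
  have hDa : logDensityRatio n α a = 0 := by
    have h1 := density_mul_exp_logDensityRatio n hα0 ha0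
    have h2 : n.factorial * (α / a ^ 2 * Real.exp (-(α / a))) = Real.exp (-a) * a ^ n := by
      have e1 : α / a = b := by rw [hαab]; field_simp
      have e2 : α / a ^ 2 = b / a := by rw [hαab]; field_simp
      have e3 : -a = -b + ((n : ℝ) + 2) * u := by rw [ha, hb]; ring
      rw [e1, e2, e3, Real.exp_add]
      rw [rhoProfile, div_eq_div_iff (by positivity) (by positivity)] at hρ2
      have e4 : n.factorial * b = a ^ (n + 1) * Real.exp (((n : ℝ) + 2) * u) := by
        rw [ha, hb, div_pow, mul_pow, pow_succ ((n : ℝ) + 2), pow_succ (2 : ℝ)]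
        field_simp
        linarith
      have : n.factorial * (b / a * Real.exp (-b)) = n.factorial * b * Real.exp (-b) / a := by ring
      rw [this, e4, pow_succ]
      field_simp
    rw [h2] at h1
    have h3 : (0 : ℝ) < Real.exp (-a) * a ^ n := by positivity
    have h4 : Real.exp (logDensityRatio n α a) = 1 := by
      have := mul_left_cancel₀ h3.ne' (h1.trans (mul_one _).symm)
      exact this
    exact (Real.exp_eq_one_iff _).1 h4
  have anti1 : StrictAntiOn (logDensityRatio n α) (Ioc 0 a) := by
    refine strictAntiOn_of_deriv_neg (convex_Ioc 0 a)
      (fun t ht => (hcont t ht.1).continuousWithinAt) fun t ht => ?_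
    rw [interior_Ioc] at ht
    rw [hderiv t ht.1]
    have : 0 < (t - a) * (t - b) := mul_pos_of_neg_of_neg (by linarith [ht.2]) (by linarith [ht.2])
    have ht0 := ht.1
    exact div_neg_of_neg_of_pos (by linarith) (by positivity)
  have mono : StrictMonoOn (logDensityRatio n α) (Icc a b) := by
    refine strictMonoOn_of_deriv_pos (convex_Icc a b)
      (fun t ht => (hcont t (ha0.trans_le ht.1)).continuousWithinAt) fun t ht => ?_
    rw [interior_Icc] at ht
    have ht0 := ha0.trans ht.1
    rw [hderiv t ht0]
    have : (t - a) * (t - b) < 0 := mul_neg_of_pos_of_neg (by linarith [ht.1]) (by linarith [ht.2])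
    exact div_pos (by linarith) (by positivity)
  have anti2 : StrictAntiOn (logDensityRatio n α) (Ici b) := by
    refine strictAntiOn_of_deriv_neg (convex_Ici b)
      (fun t ht => (hcont t (hb0.trans_le ht)).continuousWithinAt) fun t ht => ?_
    rw [interior_Ici] at ht
    have ht0 : 0 < t := hb0.trans ht
    rw [hderiv t ht0]
    have ht' : b < t := ht
    have : 0 < (t - a) * (t - b) := mul_pos (by linarith) (by linarith)
    exact div_neg_of_neg_of_pos (by linarith) (by positivity)
  have hDb : 0 < logDensityRatio n α b := by
    rw [← hDa]; exact mono ⟨le_rfl, hlt.le⟩ ⟨hlt.le, le_rfl⟩ hlt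
  -- Far out, `p` decays exponentially and `q` only like `t⁻²`. For `T ≥ α` one has `e^{-α/T} ≥
  -- e^{-1}`, which explains the threshold `n! α e^{-1}` for `T^(n+2) e^{-T}`.
  obtain ⟨T, hTb, hT⟩ : ∃ T, b ≤ T ∧ logDensityRatio n α T < 0 := by
    have hlim := Real.tendsto_pow_mul_exp_neg_atTop_nhds_zero (n + 2)
    have hpos : (0 : ℝ) < n.factorial * α * Real.exp (-1) := by positivity
    obtain ⟨T, h1, h2, h3⟩ := ((hlim.eventually_lt_const hpos).and
      ((eventually_ge_atTop b).and (eventually_ge_atTop α))).exists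
    have hT0 : 0 < T := hb0.trans_le h2
    refine ⟨T, h2, ?_⟩
    by_contra! hge
    have h4 := density_mul_exp_logDensityRatio n hα0 hT0
    have h5 : Real.exp (-1) ≤ Real.exp (-(α / T)) := by
      apply Real.exp_le_exp.2
      have : α / T ≤ 1 := (div_le_one hT0).2 h3
      linarith
    have h6 : 1 ≤ Real.exp (logDensityRatio n α T) := Real.one_le_exp hge
    have h7 : n.factorial * α * Real.exp (-1) ≤
        n.factorial * α * Real.exp (-(α / T)) * Real.exp (logDensityRatio n α T) := by
      calc _ ≤ n.factorial * α * Real.exp (-(α / T)) := by gcongr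
        _ ≤ _ := le_mul_of_one_le_right (by positivity) h6
    have h8 : n.factorial * α * Real.exp (-(α / T)) * Real.exp (logDensityRatio n α T) =
        T ^ (n + 2) * Real.exp (-T) := by
      have : n.factorial * α * Real.exp (-(α / T)) * Real.exp (logDensityRatio n α T) =
        T ^ 2 * (n.factorial * (α / T ^ 2 * Real.exp (-(α / T))) *
          Real.exp (logDensityRatio n α T)) := by field_simp
      rw [this, h4]; ring
    linarith
  obtain ⟨t₀, ht₀, hz⟩ := intermediate_value_Icc' hTb
    (fun t ht => (hcont t (hb0.trans_le ht.1)).continuousWithinAt) (show (0 : ℝ) ∈ Icc _ _ from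
      ⟨hT.le, hDb.le⟩)
  have hbt₀ : b ≤ t₀ := ht₀.1
  refine ⟨a, t₀, hb0.trans_le hbt₀, ?_, ?_⟩
  · intro t ht htt hta
    rw [← density_mul_exp_logDensityRatio n hα0 ht]
    refine lt_mul_of_one_lt_right (by positivity) (Real.one_lt_exp_iff.2 ?_)
    rcases lt_or_gt_of_ne hta with h | h
    · rw [← hDa]; exact anti1 ⟨ht, h.le⟩ ⟨ha0, le_rfl⟩ h
    · rcases le_total t b with h' | h'
      · rw [← hDa]; exact mono ⟨le_rfl, hlt.le⟩ ⟨h.le, h'⟩ h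
      · rw [← hz]; exact anti2 h' hbt₀ htt
  · intro t htt
    have ht : 0 < t := hb0.trans_le (hbt₀.trans htt.le)
    rw [← density_mul_exp_logDensityRatio n hα0 ht]
    refine mul_lt_of_lt_one_right (by positivity) (Real.exp_lt_one_iff.2 ?_)
    rw [← hz]; exact anti2 hbt₀ (hbt₀.trans htt.le) htt

/-! ### The domination inequality for antitone functions -/

lemma lintegral_exp_neg_Ioi {c : ℝ} :
    ∫⁻ t in Ioi c, ENNReal.ofReal (Real.exp (-t)) = ENNReal.ofReal (Real.exp (-c)) := by
  rw [← integral_exp_neg_Ioi c, ofReal_integral_eq_lintegral_ofReal (integrableOn_exp_neg_Ioi c)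
    (Eventually.of_forall fun _ => (Real.exp_pos _).le)]

lemma lintegral_exp_neg_mul_pow (n : ℕ) :
    ∫⁻ t in Ioi (0 : ℝ), ENNReal.ofReal (Real.exp (-t) * t ^ n) = n.factorial := by
  have h0 : (0 : ℝ) < n + 1 := by positivity
  have hi := Real.GammaIntegral_convergent h0
  have he := Real.Gamma_eq_integral h0
  simp only [add_sub_cancel_right, Real.rpow_natCast] at hi he
  rw [← ofReal_integral_eq_lintegral_ofReal hi, ← he, Real.Gamma_nat_eq_factorial,
    ENNReal.ofReal_natCast]
  filter_upwards [ae_restrict_mem measurableSet_Ioi] with t ht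
  have : (0 : ℝ) < t := ht
  positivity

lemma lintegral_comp_div {α : ℝ} (hα : 0 < α) (f : ℝ → ℝ≥0∞) :
    ∫⁻ s in Ioi (0 : ℝ), f s = ∫⁻ t in Ioi (0 : ℝ), ENNReal.ofReal (α / t ^ 2) * f (α / t) := by
  have him : (fun t : ℝ => α / t) '' Ioi 0 = Ioi 0 := by
    ext s
    constructor
    · rintro ⟨t, ht, rfl⟩; exact div_pos hα ht
    · intro hs
      exact ⟨α / s, div_pos hα hs, by field_simp⟩
  have hd : ∀ t ∈ Ioi (0 : ℝ), HasDerivWithinAt (fun t : ℝ => α / t) (-(α / t ^ 2)) (Ioi 0) t := by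
    intro t ht
    have ht0 : t ≠ 0 := ne_of_gt ht
    have := ((hasDerivAt_const t α).div (hasDerivAt_id t) ht0).hasDerivWithinAt (s := Ioi 0)
    refine this.congr_deriv ?_
    simp only [id]; field_simp; ring
  have hinj : InjOn (fun t : ℝ => α / t) (Ioi 0) := by
    intro s hs t ht h
    have hs0 : s ≠ 0 := ne_of_gt hs
    have ht0 : t ≠ 0 := ne_of_gt ht
    simp only at h
    field_simp at h
    exact h.symm
  have := lintegral_image_eq_lintegral_abs_deriv_mul measurableSet_Ioi hd hinj f
  rw [him] at this
  rw [this]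
  refine setLIntegral_congr_fun measurableSet_Ioi fun t ht => ?_
  have ht0 : (0 : ℝ) < t := ht
  simp only [abs_neg]
  rw [abs_of_pos (by positivity)]

/-- Every `t > 0` lies between two points where the value `c` is attained, and monotonicity
squeezes. -/
lemma eq_const_of_ae_eq_of_antitoneOn {g : ℝ → ℝ≥0∞} {c : ℝ≥0∞} (hg : AntitoneOn g (Ioi 0))
    (h : ∀ᵐ t ∂volume.restrict (Ioi (0 : ℝ)), g t = c) {t : ℝ} (ht : 0 < t) : g t = c := by
  rw [ae_restrict_iff' measurableSet_Ioi] at h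
  have key : ∀ x y : ℝ, 0 ≤ x → x < y → ∃ z ∈ Ioo x y, g z = c := by
    intro x y hx hxy
    by_contra! hne
    have h0 : volume (Ioo x y) = 0 := by
      refine measure_mono_null (fun z hz => ?_) h
      simpa using ⟨hx.trans_lt hz.1, hne z hz⟩
    rw [Real.volume_Ioo, ENNReal.ofReal_eq_zero] at h0
    linarith
  obtain ⟨y, hy, hyc⟩ := key 0 t le_rfl ht
  obtain ⟨z, hz, hzc⟩ := key t (t + 1) ht.le (by linarith)
  apply le_antisymm
  · rw [← hyc]; exact hg hy.1 ht hy.2.le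
  · rw [← hzc]; exact hg ht (ht.trans hz.1) hz.1.le

/-- Expresses `0 ≤ (p - q)(x - c)` without subtraction, so that it can be integrated in `ℝ≥0∞` even
when the integrals are infinite. -/
lemma ennreal_mul_add_mul_le_iff {p q : ℝ} {x c : ℝ≥0∞} (hp : 0 ≤ p) (hq : 0 ≤ q) (hx : x ≠ ⊤)
    (hc : c ≠ ⊤) :
    ENNReal.ofReal q * x + ENNReal.ofReal p * c ≤ ENNReal.ofReal p * x + ENNReal.ofReal q * c ↔
      0 ≤ (p - q) * (x.toReal - c.toReal) := by
  lift x to ℝ≥0 using hx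
  lift c to ℝ≥0 using hc
  lift p to ℝ≥0 using hp
  lift q to ℝ≥0 using hq
  simp only [ENNReal.ofReal_coe_nnreal, ENNReal.coe_toReal]
  norm_cast
  rw [← NNReal.coe_le_coe]
  push_cast
  constructor <;> intro h <;> nlinarith

/-- With `c = g t₀`, both `p - q` and `g - c` change sign at `t₀` in the same direction. Since `p`
and `q` have equal mass, the terms in `c` cancel after integration. Off the null set `{a, t₀}` one
has `p ≠ q`, so equality forces `g = c` almost everywhere. -/
lemma domination_critical (n : ℕ) (hn : 1 ≤ n) {ρ : ℝ} (hρ : IsRho n ρ) {α : ℝ}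
    (hα : α = ρ * ((n : ℝ) + 2) ^ 2) {g : ℝ → ℝ≥0∞} (hg : AntitoneOn g (Ioi 0))
    (hfin : ∀ t, 0 < t → g t ≠ ⊤) :
    n.factorial * ∫⁻ s in Ioi (0 : ℝ), ENNReal.ofReal (Real.exp (-s)) * g (α / s) ≤
        ∫⁻ t in Ioi (0 : ℝ), ENNReal.ofReal (Real.exp (-t) * t ^ n) * g t ∧
      (n.factorial * ∫⁻ s in Ioi (0 : ℝ), ENNReal.ofReal (Real.exp (-s)) * g (α / s) =
        ∫⁻ t in Ioi (0 : ℝ), ENNReal.ofReal (Real.exp (-t) * t ^ n) * g t →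
      ∫⁻ t in Ioi (0 : ℝ), ENNReal.ofReal (Real.exp (-t) * t ^ n) * g t ≠ ⊤ →
      ∀ t, 0 < t → g t = g 1) := by
  obtain ⟨a, t₀, ht₀, hlt, hgt⟩ := exists_density_crossing n hn hρ hα
  have hα0 : 0 < α := by rw [hα]; have := hρ.1.1; positivity
  set p : ℝ → ℝ := fun t => Real.exp (-t) * t ^ n with hp
  set q : ℝ → ℝ := fun t => n.factorial * (α / t ^ 2 * Real.exp (-(α / t))) with hq
  set c := g t₀ with hc
  have hctop : c ≠ ⊤ := hfin t₀ ht₀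
  have hp0 : ∀ t, 0 < t → 0 ≤ p t := fun t ht => by positivity
  have hq0 : ∀ t, 0 < t → 0 ≤ q t := fun t ht => by positivity
  have hpm : Measurable p := by fun_prop
  have hqm : Measurable q := by fun_prop
  have hgm : AEMeasurable g (volume.restrict (Ioi 0)) :=
    aemeasurable_restrict_of_antitoneOn measurableSet_Ioi hg
  have hnull : ∀ᵐ t ∂volume.restrict (Ioi (0 : ℝ)), t ≠ a ∧ t ≠ t₀ :=
    ((Measure.ae_ne volume a).and (Measure.ae_ne volume t₀)).filter_mono
      (ae_mono Measure.restrict_le_self)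
  have hfact : (n.factorial : ℝ≥0∞) = ENNReal.ofReal n.factorial := by
    rw [ENNReal.ofReal_natCast]
  have subst : ∀ f : ℝ → ℝ≥0∞,
      n.factorial * ∫⁻ s in Ioi (0 : ℝ), ENNReal.ofReal (Real.exp (-s)) * f (α / s) =
        ∫⁻ t in Ioi (0 : ℝ), ENNReal.ofReal (q t) * f t := by
    intro f
    rw [lintegral_comp_div hα0, ← lintegral_const_mul' _ _ (ENNReal.natCast_ne_top _)]
    refine setLIntegral_congr_fun measurableSet_Ioi fun t ht => ?_
    have ht0 : (0 : ℝ) < t := ht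
    have : α / (α / t) = t := by field_simp
    simp only [hq]
    rw [this, hfact, ENNReal.ofReal_mul (by positivity), ENNReal.ofReal_mul (by positivity)]
    ring
  have intp : ∫⁻ t in Ioi (0 : ℝ), ENNReal.ofReal (p t) = n.factorial :=
    lintegral_exp_neg_mul_pow n
  have intq : ∫⁻ t in Ioi (0 : ℝ), ENNReal.ofReal (q t) = n.factorial := by
    have := subst (fun _ => 1)
    simp only [mul_one] at this
    rw [← this, lintegral_exp_neg_Ioi]
    simp
  rw [subst g]
  have hsign : ∀ᵐ t ∂volume.restrict (Ioi (0 : ℝ)),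
      0 ≤ (p t - q t) * ((g t).toReal - c.toReal) ∧
        (0 = (p t - q t) * ((g t).toReal - c.toReal) → g t = c) := by
    filter_upwards [hnull, ae_restrict_mem measurableSet_Ioi] with t hne ht
    have hz : 0 ≠ p t - q t → 0 = (p t - q t) * ((g t).toReal - c.toReal) → g t = c := by
      intro h h'
      rcases mul_eq_zero.1 h'.symm with h1 | h1
      · exact absurd h1.symm h
      · exact (ENNReal.toReal_eq_toReal_iff' (hfin t ht) hctop).1 (sub_eq_zero.1 h1)
    rcases lt_or_gt_of_ne hne.2 with h | h
    · have h1 := hlt t ht h hne.1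
      have h2 : c.toReal ≤ (g t).toReal :=
        ENNReal.toReal_mono (hfin t ht) (hg ht ht₀ h.le)
      exact ⟨mul_nonneg (sub_nonneg.2 h1.le) (sub_nonneg.2 h2), hz (sub_pos.2 h1).ne⟩
    · have h1 := hgt t h
      have h2 : (g t).toReal ≤ c.toReal := ENNReal.toReal_mono hctop (hg ht₀ ht h.le)
      exact ⟨mul_nonneg_of_nonpos_of_nonpos (sub_nonpos.2 h1.le) (sub_nonpos.2 h2),
        hz (sub_neg.2 h1).ne'⟩
  have hle : ∀ᵐ t ∂volume.restrict (Ioi (0 : ℝ)),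
      ENNReal.ofReal (q t) * g t + ENNReal.ofReal (p t) * c ≤
        ENNReal.ofReal (p t) * g t + ENNReal.ofReal (q t) * c := by
    filter_upwards [hsign, ae_restrict_mem measurableSet_Ioi] with t h ht
    exact (ennreal_mul_add_mul_le_iff (hp0 t ht) (hq0 t ht) (hfin t ht) hctop).2 h.1
  have hKtop : n.factorial * c ≠ ⊤ := ENNReal.mul_ne_top (ENNReal.natCast_ne_top _) hctop
  have I1 : ∫⁻ t in Ioi (0 : ℝ), (ENNReal.ofReal (q t) * g t + ENNReal.ofReal (p t) * c) =
      (∫⁻ t in Ioi (0 : ℝ), ENNReal.ofReal (q t) * g t) + n.factorial * c := by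
    rw [lintegral_add_right _ (by fun_prop), lintegral_mul_const _ (by fun_prop), intp]
  have I2 : ∫⁻ t in Ioi (0 : ℝ), (ENNReal.ofReal (p t) * g t + ENNReal.ofReal (q t) * c) =
      (∫⁻ t in Ioi (0 : ℝ), ENNReal.ofReal (p t) * g t) + n.factorial * c := by
    rw [lintegral_add_right _ (by fun_prop), lintegral_mul_const _ (by fun_prop), intq]
  refine ⟨?_, ?_⟩
  · have := lintegral_mono_ae hle
    rw [I1, I2] at this
    exact (ENNReal.add_le_add_iff_right hKtop).1 this
  · intro heq hne
    have hae := ae_eq_of_ae_le_of_lintegral_le hle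
      (by rw [I1, heq]; exact ENNReal.add_ne_top.2 ⟨hne, hKtop⟩) (by fun_prop)
      (by rw [I1, I2, heq])
    have hgc : ∀ᵐ t ∂volume.restrict (Ioi (0 : ℝ)), g t = c := by
      filter_upwards [hsign, hae, ae_restrict_mem measurableSet_Ioi] with t h he ht
      refine h.2 (le_antisymm h.1 ?_)
      have := (ennreal_mul_add_mul_le_iff (hq0 t ht) (hp0 t ht) (hfin t ht) hctop).1 he.ge
      linarith
    intro t ht
    rw [eq_const_of_ae_eq_of_antitoneOn hg hgc ht,
      eq_const_of_ae_eq_of_antitoneOn hg hgc one_pos]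

/-- For antitone `g` and `α ≥ ρ (n + 2)²`, the mean of `g (α / s)` against the exponential
distribution is at most the mean of `g` against the Gamma distribution of shape `n + 1`. -/
theorem domination (n : ℕ) (hn : 1 ≤ n) {ρ : ℝ} (hρ : IsRho n ρ) {α : ℝ}
    (hα : ρ * ((n : ℝ) + 2) ^ 2 ≤ α) {g : ℝ → ℝ≥0∞} (hg : AntitoneOn g (Ioi 0))
    (hfin : ∀ t, 0 < t → g t ≠ ⊤) :
    n.factorial * ∫⁻ s in Ioi (0 : ℝ), ENNReal.ofReal (Real.exp (-s)) * g (α / s) ≤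
        ∫⁻ t in Ioi (0 : ℝ), ENNReal.ofReal (Real.exp (-t) * t ^ n) * g t ∧
      (∫⁻ t in Ioi (0 : ℝ), ENNReal.ofReal (Real.exp (-t) * t ^ n) * g t ≠ ⊤ →
      (n.factorial * ∫⁻ s in Ioi (0 : ℝ), ENNReal.ofReal (Real.exp (-s)) * g (α / s) =
        ∫⁻ t in Ioi (0 : ℝ), ENNReal.ofReal (Real.exp (-t) * t ^ n) * g t ↔
      ∀ t, 0 < t → g t = g 1)) := by
  obtain ⟨h1, h2⟩ := domination_critical n hn hρ rfl hg hfin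
  have hα0 : 0 < ρ * ((n : ℝ) + 2) ^ 2 := by have := hρ.1.1; positivity
  have hmono : n.factorial * ∫⁻ s in Ioi (0 : ℝ), ENNReal.ofReal (Real.exp (-s)) * g (α / s) ≤
      n.factorial * ∫⁻ s in Ioi (0 : ℝ), ENNReal.ofReal (Real.exp (-s)) *
        g (ρ * ((n : ℝ) + 2) ^ 2 / s) := by
    refine mul_le_mul' le_rfl ?_
    refine setLIntegral_mono' measurableSet_Ioi fun s hs => ?_
    have hs0 : (0 : ℝ) < s := hs
    gcongr
    exact hg (div_pos hα0 hs0) (div_pos (hα0.trans_le hα) hs0) (by gcongr)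
  -- Equality at `α` pinches the chain through the critical parameter, so it is also equality there.
  refine ⟨hmono.trans h1, fun hne => ⟨fun heq => h2 (le_antisymm h1 (heq ▸ hmono)) hne, ?_⟩⟩
  intro hconst
  have e1 : ∫⁻ s in Ioi (0 : ℝ), ENNReal.ofReal (Real.exp (-s)) * g (α / s) = g 1 := by
    have : ∀ s ∈ Ioi (0 : ℝ), ENNReal.ofReal (Real.exp (-s)) * g (α / s) =
        ENNReal.ofReal (Real.exp (-s)) * g 1 := fun s hs => by
      rw [hconst (α / s) (div_pos (hα0.trans_le hα) hs)]
    rw [setLIntegral_congr_fun measurableSet_Ioi this,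
      lintegral_mul_const _ (by fun_prop), lintegral_exp_neg_Ioi]
    simp
  have e2 : ∫⁻ t in Ioi (0 : ℝ), ENNReal.ofReal (Real.exp (-t) * t ^ n) * g t =
      n.factorial * g 1 := by
    have : ∀ t ∈ Ioi (0 : ℝ), ENNReal.ofReal (Real.exp (-t) * t ^ n) * g t =
        ENNReal.ofReal (Real.exp (-t) * t ^ n) * g 1 := fun t ht => by rw [hconst t ht]
    rw [setLIntegral_congr_fun measurableSet_Ioi this,
      lintegral_mul_const _ (by fun_prop), lintegral_exp_neg_mul_pow]
  rw [e1, e2]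

variable {n : ℕ}

/-! ### Volumes of convex sets -/

section ConvexSets

variable {E : Type*} [NormedAddCommGroup E] [NormedSpace ℝ E]
  [MeasurableSpace E] [BorelSpace E] {μ : Measure E} [μ.IsAddHaarMeasure]

/-- The frontier of a convex set is null, so a convex set with empty interior is null. -/
lemma interior_nonempty_of_convex_of_measure_ne_zero [FiniteDimensional ℝ E] {K : Set E} (hK : Convex ℝ K)
    (h : μ K ≠ 0) : (interior K).Nonempty := by
  by_contra hne
  rw [not_nonempty_iff_eq_empty] at hne
  apply h
  refine measure_mono_null ?_ (hK.addHaar_frontier μ)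
  rw [frontier, hne, sdiff_empty]
  exact subset_closure

/-- `interior B \ A` is open and null, hence empty; a convex set with interior points lies in the
closure of its interior, and `A` is closed. -/
lemma eq_of_subset_of_measure_eq [FiniteDimensional ℝ E] {A B : Set E} (hA : IsClosed A) (hB : Convex ℝ B) (hAB : A ⊆ B)
    (h0 : μ B ≠ 0) (htop : μ B ≠ ⊤) (h : μ A = μ B) : A = B := by
  refine hAB.antisymm ?_
  have hint := interior_nonempty_of_convex_of_measure_ne_zero hB h0
  have hnull : μ (B \ A) = 0 := by
    rw [measure_sdiff hAB hA.measurableSet.nullMeasurableSet (h ▸ htop), h, tsub_self]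
  have hopen : IsOpen (interior B \ A) := isOpen_interior.sdiff hA
  have hempty : interior B \ A = ∅ :=
    (hopen.measure_eq_zero_iff μ).1
      (measure_mono_null (sdiff_subset_sdiff_left interior_subset) hnull)
  calc B ⊆ closure B := subset_closure
    _ = closure (interior B) := (hB.closure_interior_eq_closure_of_nonempty_interior hint).symm
    _ ⊆ closure A := closure_mono (sdiff_eq_empty.1 hempty)
    _ = A := hA.closure_eq

/-- An unbounded convex set containing a ball contains arbitrarily many disjoint balls of half the
radius, strung towards a far point. -/
lemma isBounded_of_convex_of_measure_ne_top {K : Set E} (hK : Convex ℝ K)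
    (hint : (interior K).Nonempty) (htop : μ K ≠ ⊤) : Bornology.IsBounded K := by
  obtain ⟨a, ha⟩ := hint
  obtain ⟨r, hr, hball⟩ := Metric.mem_nhds_iff.1 (mem_interior_iff_mem_nhds.1 ha)
  by_contra hub
  have hpos : 0 < μ (Metric.ball a (r / 2)) := Metric.measure_ball_pos μ a (by positivity)
  have key : ∀ N : ℕ, (N : ℝ≥0∞) * μ (Metric.ball a (r / 2)) ≤ μ K := by
    intro N
    obtain ⟨x, hxK, hx⟩ : ∃ x ∈ K, 2 * (N + 1) * r < dist x a := by
      by_contra! h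
      exact hub ((Metric.isBounded_iff_subset_closedBall a).2 ⟨_, fun x hx => h x hx⟩)
    -- The parameters `i / (2(N+1))` stay below `1/2`, so shrinking the ball of radius `r` towards
    -- `x` leaves radius at least `r/2`; consecutive centres are more than `r` apart.
    set c : ℕ → E := fun i => a + ((i : ℝ) / (2 * (N + 1))) • (x - a) with hc
    have hsub : ∀ i ∈ Finset.range N, Metric.ball (c i) (r / 2) ⊆ K := by
      intro i hi z hz
      have hiN : (i : ℝ) < N := by exact_mod_cast Finset.mem_range.1 hi
      set t : ℝ := (i : ℝ) / (2 * (N + 1)) with ht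
      have ht0 : 0 ≤ t := by positivity
      have ht1 : t ≤ 1 / 2 := by
        rw [ht, div_le_div_iff₀ (by positivity) (by positivity)]; linarith
      have h1t : 0 < 1 - t := by linarith
      set v := z - c i with hv
      have hvn : ‖v‖ < r / 2 := by rwa [mem_ball_iff_norm] at hz
      have hw : a + (1 - t)⁻¹ • v ∈ K := by
        apply hball
        rw [mem_ball_iff_norm, add_sub_cancel_left, norm_smul, Real.norm_of_nonneg (by positivity)]
        have h2 : (1 - t)⁻¹ ≤ 2 := by
          rw [inv_le_comm₀ h1t two_pos]; linarith
        calc (1 - t)⁻¹ * ‖v‖ ≤ 2 * ‖v‖ := by gcongr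
          _ < r := by linarith
      have := hK hw hxK h1t.le ht0 (by ring)
      have e : (1 - t) • (a + (1 - t)⁻¹ • v) + t • x = z := by
        rw [smul_add, smul_inv_smul₀ h1t.ne', hv, hc]
        simp only [← ht]
        module
      rwa [e] at this
    have hdisj : (Finset.range N : Set ℕ).PairwiseDisjoint fun i => Metric.ball (c i) (r / 2) := by
      intro i _ j _ hij
      apply Metric.ball_disjoint_ball
      have e : c i - c j = (((i : ℝ) - j) / (2 * (N + 1))) • (x - a) := by
        simp only [hc]; module
      have h1 : (1 : ℝ) ≤ |(i : ℝ) - j| := by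
        have : (1 : ℤ) ≤ |(i : ℤ) - j| := Int.one_le_abs (by omega)
        exact_mod_cast this
      rw [dist_eq_norm, e, norm_smul, Real.norm_eq_abs, abs_div, abs_of_pos (a := 2 * ((N : ℝ) + 1))
        (by positivity), ← dist_eq_norm, add_halves, div_mul_eq_mul_div, le_div_iff₀ (by positivity)]
      calc r * (2 * (N + 1)) = 2 * (N + 1) * r := by ring
        _ ≤ dist x a := hx.le
        _ ≤ _ := le_mul_of_one_le_left dist_nonneg h1
    calc (N : ℝ≥0∞) * μ (Metric.ball a (r / 2))
        = ∑ i ∈ Finset.range N, μ (Metric.ball (c i) (r / 2)) := by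
          simp [Measure.addHaar_ball_center μ (_ : E) (r / 2)]
      _ = μ (⋃ i ∈ Finset.range N, Metric.ball (c i) (r / 2)) :=
          (measure_biUnion_finset hdisj fun i _ => measurableSet_ball).symm
      _ ≤ μ K := measure_mono (iUnion₂_subset hsub)
  obtain ⟨N, hN⟩ := ENNReal.exists_nat_mul_gt hpos.ne' htop
  exact absurd (key N) (not_le.2 hN)

end ConvexSets

/-! ### Sublevel sets and the gauge transform -/

section Sublevels

variable {φ : Sp n → ℝ≥0∞}

lemma IsGeometricConvex.isClosed_sublevel (hφ : IsGeometricConvex φ) (T : ℝ≥0∞) :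
    IsClosed {x | φ x ≤ T} :=
  lowerSemicontinuous_iff_isClosed_preimage.1 hφ.lsc T

lemma IsGeometricConvex.map_add_le (hφ : IsGeometricConvex φ) (x y : Sp n) {a b : ℝ}
    (ha : 0 ≤ a) (hb : 0 ≤ b) (hab : a + b = 1) :
    φ (a • x + b • y) ≤ ENNReal.ofReal a * φ x + ENNReal.ofReal b * φ y := by
  lift a to ℝ≥0 using ha
  lift b to ℝ≥0 using hb
  have := hφ.convex.2 (mem_univ x) (mem_univ y) (zero_le : 0 ≤ a) (zero_le : 0 ≤ b)
    (by exact_mod_cast hab)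
  simpa [NNReal.smul_def, ENNReal.smul_def] using this

lemma IsGeometricConvex.convex_sublevel (hφ : IsGeometricConvex φ) (T : ℝ≥0∞) :
    Convex ℝ {x | φ x ≤ T} := by
  intro x hx y hy a b ha hb hab
  refine (hφ.map_add_le x y ha hb hab).trans ?_
  have hx' : φ x ≤ T := hx
  have hy' : φ y ≤ T := hy
  calc _ ≤ ENNReal.ofReal a * T + ENNReal.ofReal b * T := by gcongr
    _ = T := by rw [← add_mul, ← ENNReal.ofReal_add ha hb, hab, ENNReal.ofReal_one, one_mul]

lemma IsGeometricConvex.map_smul_le (hφ : IsGeometricConvex φ) (x : Sp n) {a : ℝ}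
    (ha : 0 ≤ a) (ha1 : a ≤ 1) : φ (a • x) ≤ ENNReal.ofReal a * φ x := by
  simpa [hφ.map_zero] using hφ.map_add_le x 0 ha (sub_nonneg.2 ha1) (by ring)

lemma IsGeometricConvex.smul_sublevel_subset (hφ : IsGeometricConvex φ) {s t : ℝ} (hs : 0 < s)
    (hst : s ≤ t) :
    (s / t) • {x | φ x ≤ ENNReal.ofReal t} ⊆ {x | φ x ≤ ENNReal.ofReal s} := by
  rintro _ ⟨x, hx, rfl⟩
  have ht : 0 < t := hs.trans_le hst
  have hx' : φ x ≤ ENNReal.ofReal t := hx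
  calc φ ((s / t) • x) ≤ ENNReal.ofReal (s / t) * φ x :=
        hφ.map_smul_le x (by positivity) ((div_le_one ht).2 hst)
    _ ≤ ENNReal.ofReal (s / t) * ENNReal.ofReal t := by gcongr
    _ = ENNReal.ofReal s := by
        rw [← ENNReal.ofReal_mul (by positivity), div_mul_cancel₀ _ ht.ne']

/-- A point outside a sublevel set is detected by the Legendre transform. -/
lemma IsGeometricConvex.exists_legendre_lt (hφ : IsGeometricConvex φ) {z : Sp n} {c : ℝ}
    (hc : 0 ≤ c) (hz : ENNReal.ofReal c < φ z) :
    ∃ x : Sp n, legendre φ x < ENNReal.ofReal (inner ℝ x z - c) := by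
  -- The condition `0 ≤ p.2` is needed because `ENNReal.ofReal` sends negative heights to `0`.
  set epi : Set (Sp n × ℝ) := {p | φ p.1 ≤ ENNReal.ofReal p.2 ∧ 0 ≤ p.2} with hepi
  have hclosed : IsClosed epi := by
    refine IsClosed.inter ?_ (isClosed_le continuous_const continuous_snd)
    exact hφ.lsc.isClosed_epigraph.preimage
      (f := fun p : Sp n × ℝ => (p.1, ENNReal.ofReal p.2))
      (continuous_fst.prodMk (ENNReal.continuous_ofReal.comp continuous_snd))
  have hconvex : Convex ℝ epi := by
    rintro ⟨x, r⟩ ⟨hx, hr⟩ ⟨y, s⟩ ⟨hy, hs⟩ a b ha hb hab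
    simp only at hx hr hy hs
    refine ⟨(hφ.map_add_le x y ha hb hab).trans ?_, ?_⟩
    · simp only [Prod.snd_add, Prod.smul_snd, smul_eq_mul]
      rw [ENNReal.ofReal_add (by positivity) (by positivity), ENNReal.ofReal_mul ha,
        ENNReal.ofReal_mul hb]
      gcongr
    · simp only [Prod.snd_add, Prod.smul_snd, smul_eq_mul]; positivity
  have hnot : (z, c) ∉ epi := fun h => absurd h.1 (not_le.2 hz)
  obtain ⟨f, u, hfu, huf⟩ := geometric_hahn_banach_closed_point hconvex hclosed hnot
  set ℓ : StrongDual ℝ (Sp n) := f.comp (ContinuousLinearMap.inl ℝ (Sp n) ℝ) with hℓ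
  set β : ℝ := f (0, 1) with hβ
  have hf : ∀ w r, f (w, r) = ℓ w + r * β := by
    intro w r
    have : ((w, r) : Sp n × ℝ) = (w, 0) + r • ((0 : Sp n), (1 : ℝ)) := by simp
    rw [this, map_add, map_smul]; rfl
  set v : Sp n := (InnerProductSpace.toDual ℝ (Sp n)).symm ℓ with hv
  have hvℓ : ∀ w, inner ℝ v w = ℓ w := fun w => InnerProductSpace.toDual_symm_apply
  have hu0 : 0 < u := by
    have := hfu (0, 0) ⟨by simp [hφ.map_zero], le_rfl⟩
    rw [hf] at this; simpa using this
  have hβ0 : β ≤ 0 := by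
    by_contra! h
    have := hfu (0, u / β) ⟨by simp [hφ.map_zero], by positivity⟩
    rw [hf, _root_.map_zero, zero_add, div_mul_cancel₀ _ h.ne'] at this
    exact lt_irrefl _ this
  have hval : ∀ w, φ w ≠ ⊤ → inner ℝ v w < u - (φ w).toReal * β := by
    intro w hw
    have := hfu (w, (φ w).toReal) ⟨by rw [ENNReal.ofReal_toReal hw], ENNReal.toReal_nonneg⟩
    rw [hf] at this
    rw [hvℓ]; linarith
  rw [hf] at huf
  rw [← hvℓ] at huf
  -- Rescale the separating hyperplane to an affine minorant of `φ` exceeding `c` at `z`. If it is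
  -- not vertical, normalise its slope to `1`; if it is vertical, any large multiple works because
  -- `φ ≥ 0`.
  obtain ⟨k, hk, hkβ, hkz⟩ : ∃ k : ℝ, 0 < k ∧ -(k * β) ≤ 1 ∧ k * u < k * inner ℝ v z - c := by
    rcases hβ0.lt_or_eq with h | h
    · refine ⟨(-β)⁻¹, by rw [inv_pos]; linarith, ?_, ?_⟩
      · have : β ≠ 0 := h.ne
        apply le_of_eq; field_simp
      · have hb : 0 < -β := by linarith
        have := mul_lt_mul_of_pos_left huf (inv_pos.2 hb)
        have e : (-β)⁻¹ * (inner ℝ v z + c * β) = (-β)⁻¹ * inner ℝ v z - c := by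
          have : β ≠ 0 := h.ne
          field_simp
          ring
        rwa [e] at this
    · rw [h, mul_zero, add_zero] at huf
      have hd : 0 < inner ℝ v z - u := by linarith
      refine ⟨(c + 1) / (inner ℝ v z - u), by positivity, by simp [h], ?_⟩
      have : (c + 1) / (inner ℝ v z - u) * (inner ℝ v z - u) = c + 1 := by field_simp
      rw [mul_sub] at this
      linarith
  refine ⟨k • v, lt_of_le_of_lt (b := ENNReal.ofReal (k * u)) ?_ ?_⟩
  · refine iSup_le fun w => ?_
    by_cases hw : φ w = ⊤
    · simp [hw]
    · rw [tsub_le_iff_right]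
      conv_rhs => rw [← ENNReal.ofReal_toReal hw]
      rw [← ENNReal.ofReal_add (by positivity) ENNReal.toReal_nonneg, real_inner_comm,
        real_inner_smul_left]
      apply ENNReal.ofReal_le_ofReal
      have h1 := mul_lt_mul_of_pos_left (hval w hw) hk
      have h2 : (φ w).toReal * -(k * β) ≤ (φ w).toReal * 1 :=
        mul_le_mul_of_nonneg_left hkβ ENNReal.toReal_nonneg
      linarith
  · rw [real_inner_smul_left]
    exact (ENNReal.ofReal_lt_ofReal_iff_of_nonneg (by positivity)).2 hkz

/-- The gauge transform acts on sublevel sets by `{Jφ ≤ s} = s {φ ≤ 1/s}`. -/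
theorem IsGeometricConvex.gaugeTransform_le_iff (hφ : IsGeometricConvex φ) {s : ℝ} (hs : 0 < s)
    (y : Sp n) :
    gaugeTransform φ y ≤ ENNReal.ofReal s ↔ φ (s⁻¹ • y) ≤ ENNReal.ofReal s⁻¹ := by
  -- Clearing denominators turns the bound into `LLφ (s⁻¹y) ≤ s⁻¹`; what remains is `LLφ = φ`.
  have hterm : gaugeTransform φ y ≤ ENNReal.ofReal s ↔
      ∀ x, ENNReal.ofReal (inner ℝ x (s⁻¹ • y) - s⁻¹) ≤ legendre φ x := by
    rw [gaugeTransform, polarity, iSup_le_iff]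
    refine forall_congr' fun x => ?_
    have hs' : ENNReal.ofReal s ≠ 0 := by simpa using hs
    rw [ENNReal.div_le_iff_le_mul (Or.inr ENNReal.ofReal_ne_top) (Or.inr hs'), real_inner_smul_right]
    have : inner ℝ x y - 1 = s * (s⁻¹ * inner ℝ x y - s⁻¹) := by field_simp
    rw [this, ENNReal.ofReal_mul hs.le]
    exact ENNReal.mul_le_mul_iff_right hs' ENNReal.ofReal_ne_top
  rw [hterm]
  constructor
  · intro h
    by_contra! hlt
    obtain ⟨x, hx⟩ := hφ.exists_legendre_lt (inv_nonneg.2 hs.le) hlt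
    exact absurd (h x) (not_le.2 hx)
  · intro h x
    refine le_trans ?_ (le_iSup _ (s⁻¹ • y))
    rw [ENNReal.ofReal_sub _ (inv_nonneg.2 hs.le), real_inner_comm]
    exact tsub_le_tsub_left h _

end Sublevels

/-! ### Measurability and the layer-cake formula -/

lemma lowerSemicontinuous_polarity (f : Sp n → ℝ≥0∞) : LowerSemicontinuous (polarity f) := by
  refine lowerSemicontinuous_iSup fun x => ?_
  by_cases h0 : f x = 0
  -- Division by `0` makes this term the `∞`-indicator of a closed half-space.
  · rw [lowerSemicontinuous_iff_isClosed_preimage]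
    intro T
    by_cases hT : T = ⊤
    · simp [hT]
    · have : (fun y : Sp n => ENNReal.ofReal (inner ℝ x y - 1) / f x) ⁻¹' Iic T =
          {y | inner ℝ x y - 1 ≤ 0} := by
        ext y
        simp only [mem_preimage, mem_Iic, h0, mem_ofPred_eq]
        rw [← ENNReal.ofReal_eq_zero]
        constructor
        · intro h
          by_contra hne
          rw [ENNReal.div_zero hne] at h
          exact hT (top_le_iff.1 h)
        · intro h; simp [h]
      rw [this]
      exact isClosed_le (by fun_prop) continuous_const
  · refine Continuous.lowerSemicontinuous ?_
    simp only [div_eq_mul_inv]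
    have h : (f x)⁻¹ ≠ ⊤ := ENNReal.inv_ne_top.2 h0
    exact (ENNReal.continuous_mul_const h).comp (ENNReal.continuous_ofReal.comp (by fun_prop))

lemma exp_neg_eq_lintegral (a : ℝ≥0∞) :
    EReal.exp (-(a : EReal)) =
      ∫⁻ t in Ioi (0 : ℝ), if a ≤ ENNReal.ofReal t then ENNReal.ofReal (Real.exp (-t)) else 0 := by
  rcases eq_or_ne a ⊤ with rfl | ha
  · simp
  · lift a to ℝ≥0 using ha
    have e : ∀ᵐ t : ℝ ∂volume.restrict (Ioi 0),
        (if (a : ℝ≥0∞) ≤ ENNReal.ofReal t then ENNReal.ofReal (Real.exp (-t)) else 0) =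
        (Ioi (a : ℝ)).indicator (fun t => ENNReal.ofReal (Real.exp (-t))) t := by
      filter_upwards [ae_restrict_mem measurableSet_Ioi,
        ae_mono Measure.restrict_le_self (Measure.ae_ne volume (a : ℝ))] with t ht hta
      have ht0 : (0 : ℝ) ≤ t := le_of_lt ht
      have : (a : ℝ≥0∞) ≤ ENNReal.ofReal t ↔ t ∈ Ioi (a : ℝ) := by
        rw [← ENNReal.ofReal_coe_nnreal, ENNReal.ofReal_le_ofReal_iff ht0, mem_Ioi]
        exact ⟨fun h => lt_of_le_of_ne h (Ne.symm hta), le_of_lt⟩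
      simp only [this, indicator]
    rw [lintegral_congr_ae e, lintegral_indicator measurableSet_Ioi,
      Measure.restrict_restrict measurableSet_Ioi,
      inter_eq_self_of_subset_left (Ioi_subset_Ioi a.coe_nonneg), lintegral_exp_neg_Ioi, ← EReal.exp_coe]
    congr 1

/-- The integral of `e^{-φ}` in terms of the volumes of the sublevel sets of `φ`. -/
theorem expIntegral_eq_lintegral_volume {φ : Sp n → ℝ≥0∞} (hφ : Measurable φ) :
    expIntegral φ = ∫⁻ t in Ioi (0 : ℝ),
      ENNReal.ofReal (Real.exp (-t)) * volume {x | φ x ≤ ENNReal.ofReal t} := by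
  simp only [expIntegral, exp_neg_eq_lintegral]
  rw [lintegral_lintegral_swap]
  · refine lintegral_congr fun t => ?_
    have hm : MeasurableSet {x | φ x ≤ ENNReal.ofReal t} := measurableSet_le hφ measurable_const
    rw [← lintegral_indicator_const hm]
    simp only [indicator, mem_ofPred_eq]
  · refine Measurable.aemeasurable ?_
    refine Measurable.ite ?_ (by fun_prop) measurable_const
    exact measurableSet_le (by fun_prop) (by fun_prop)

/-! ### Gauges and indicators of convex bodies -/

section Bodies

variable {K : Set (Sp n)}

lemma IsBodyWithInteriorOrigin.isBodyWithOrigin (hK : IsBodyWithInteriorOrigin K) :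
    IsBodyWithOrigin K :=
  ⟨hK.compact, hK.convex, ⟨0, hK.zero_mem_interior⟩, interior_subset hK.zero_mem_interior⟩

lemma minkowski_lt_top_iff {x : Sp n} : minkowski K x < ⊤ ↔ ∃ r : ℝ, 0 < r ∧ x ∈ r • K := by
  simp [minkowski, iInf_lt_iff]

lemma IsBodyWithOrigin.minkowski_le_iff (hK : IsBodyWithOrigin K) {t : ℝ} (ht : 0 < t)
    (x : Sp n) : minkowski K x ≤ ENNReal.ofReal t ↔ x ∈ t • K := by
  refine ⟨fun h => ?_, fun h => iInf₂_le t ⟨ht, h⟩⟩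
  -- The infimum need not be known to be attained: closedness of `K` allows `r ↓ t`.
  have hr : ∀ r, t < r → r⁻¹ • x ∈ K := by
    intro r htr
    have hr0 : 0 < r := ht.trans htr
    have hlt : minkowski K x < ENNReal.ofReal r :=
      h.trans_lt ((ENNReal.ofReal_lt_ofReal_iff hr0).2 htr)
    simp only [minkowski, iInf_lt_iff] at hlt
    obtain ⟨r', ⟨hr', k, hk, rfl⟩, hlt⟩ := hlt
    have hlt' : r' < r := (ENNReal.ofReal_lt_ofReal_iff hr0).1 hlt
    have := hK.convex.smul_mem_of_zero_mem hK.zero_mem hk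
      (t := r⁻¹ * r') ⟨by positivity, by rw [inv_mul_le_one₀ hr0]; exact hlt'.le⟩
    simpa [smul_smul] using this
  rw [mem_smul_set_iff_inv_smul_mem₀ ht.ne']
  have hlim : Tendsto (fun r : ℝ => r⁻¹ • x) (𝓝[>] t) (𝓝 (t⁻¹ • x)) :=
    ((tendsto_inv₀ ht.ne').smul_const x).mono_left nhdsWithin_le_nhds
  refine hK.compact.isClosed.mem_of_tendsto hlim ?_
  filter_upwards [self_mem_nhdsWithin] with r hr' using hr r hr'

/-- `L‖·‖_K` is `∞` at `x` as soon as `⟨x, y⟩ > 1` for some `y ∈ K` (go along the ray of `y`), which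
kills the terms of `A` at such `y`. For `y ∉ K`, a separating `v` with `⟨v, ·⟩ ≤ 1` on `K` has
`L‖·‖_K v = 0` and gives an infinite term. -/
theorem IsBodyWithOrigin.gaugeTransform_minkowski (hK : IsBodyWithOrigin K) :
    gaugeTransform (minkowski K) = convexIndicator K := by
  funext y
  by_cases hy : y ∈ K
  · rw [convexIndicator, if_pos hy, gaugeTransform, polarity, ENNReal.iSup_eq_zero]
    intro x
    rcases le_or_gt (inner ℝ x y) 1 with h | h
    · rw [ENNReal.ofReal_of_nonpos (by linarith), ENNReal.zero_div]
    · have htop : legendre (minkowski K) x = ⊤ := by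
        refine ENNReal.eq_top_of_forall_nnreal_le fun r => ?_
        have hd : 0 < inner ℝ x y - 1 := by linarith
        set c : ℝ := (r + 1) / (inner ℝ x y - 1) with hc
        have hc0 : 0 < c := by positivity
        have hm : minkowski K (c • y) ≤ ENNReal.ofReal c :=
          iInf₂_le c ⟨hc0, smul_mem_smul_set hy⟩
        refine le_trans ?_ (le_iSup _ (c • y))
        refine le_trans ?_ (tsub_le_tsub_left hm _)
        rw [← ENNReal.ofReal_sub _ hc0.le, real_inner_smul_left, real_inner_comm]
        have : c * inner ℝ x y - c = r + 1 := by rw [hc]; field_simp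
        rw [this, ← ENNReal.ofReal_coe_nnreal]
        exact ENNReal.ofReal_le_ofReal (by linarith)
      rw [htop, ENNReal.div_top]
  · rw [convexIndicator, if_neg hy, eq_top_iff]
    obtain ⟨f, u, hfu, huf⟩ :=
      geometric_hahn_banach_closed_point hK.convex hK.compact.isClosed hy
    have hu0 : 0 < u := by simpa using hfu 0 hK.zero_mem
    set v : Sp n := u⁻¹ • (InnerProductSpace.toDual ℝ (Sp n)).symm f with hv
    have hvf : ∀ w, inner ℝ v w = u⁻¹ * f w := fun w => by
      rw [hv, real_inner_smul_left, InnerProductSpace.toDual_symm_apply]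
    have hL : legendre (minkowski K) v = 0 := by
      rw [legendre, ENNReal.iSup_eq_zero]
      intro w
      rw [tsub_eq_zero_iff_le]
      refine le_iInf₂ fun r hr => ENNReal.ofReal_le_ofReal ?_
      obtain ⟨hr0, k, hk, rfl⟩ := hr
      simp only [real_inner_smul_left]
      rw [real_inner_comm, hvf]
      refine mul_le_of_le_one_right hr0.le ?_
      rw [inv_mul_le_one₀ hu0]
      exact (hfu k hk).le
    refine le_trans ?_ (le_iSup _ v)
    rw [hL, ENNReal.div_zero]
    have : 1 < u⁻¹ * f y := by rw [← div_eq_inv_mul, one_lt_div hu0]; exact huf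
    rw [hvf, ← pos_iff_ne_zero, ENNReal.ofReal_pos]
    linarith

/-- Otherwise a functional is nonpositive on `A` and negative at some `a` in its interior,
contradicting that a positive multiple of `-a` lies in `A`. -/
lemma zero_mem_interior_of_absorbing {E : Type*} [NormedAddCommGroup E] [NormedSpace ℝ E]
    {A : Set E} (hA : Convex ℝ A) (hint : (interior A).Nonempty)
    (habs : ∀ x, ∃ c : ℝ, 0 < c ∧ c • x ∈ A) : (0 : E) ∈ interior A := by
  by_contra h0
  obtain ⟨f, hf⟩ := geometric_hahn_banach_open_point hA.interior isOpen_interior h0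
  rw [map_zero] at hf
  have hle : ∀ a ∈ A, f a ≤ 0 := by
    have : closure (interior A) ⊆ {a | f a ≤ 0} :=
      closure_minimal (fun a ha => (hf a ha).le) (isClosed_le f.continuous continuous_const)
    rw [hA.closure_interior_eq_closure_of_nonempty_interior hint] at this
    exact fun a ha => this (subset_closure ha)
  obtain ⟨a, ha⟩ := hint
  obtain ⟨c, hc, hca⟩ := habs (-a)
  have h1 := hle _ hca
  have h2 := hf a ha
  rw [map_smul, map_neg, smul_eq_mul] at h1
  nlinarith

lemma IsBodyWithOrigin.interiorOrigin_of_minkowski (hK : IsBodyWithOrigin K)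
    (h0 : (0 : Sp n) ∈ interior {x | minkowski K x < ⊤}) : IsBodyWithInteriorOrigin K := by
  refine ⟨hK.compact, hK.convex,
    zero_mem_interior_of_absorbing hK.convex hK.interior_nonempty fun x => ?_⟩
  have hlim : Tendsto (fun d : ℝ => d • x) (𝓝[>] 0) (𝓝 0) := by
    have : Tendsto (fun d : ℝ => d • x) (𝓝 0) (𝓝 ((0 : ℝ) • x)) :=
      (continuous_id.smul continuous_const).tendsto 0
    rw [zero_smul] at this
    exact this.mono_left nhdsWithin_le_nhds
  obtain ⟨d, hd, hd0⟩ :=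
    ((hlim.eventually_mem (mem_interior_iff_mem_nhds.1 h0)).and self_mem_nhdsWithin).exists
  obtain ⟨r, hr, hx⟩ := minkowski_lt_top_iff.1 hd
  rw [mem_smul_set_iff_inv_smul_mem₀ hr.ne', smul_smul] at hx
  exact ⟨_, mul_pos (inv_pos.2 hr) hd0, hx⟩

lemma IsBodyWithOrigin.interiorOrigin_of_convexIndicator (hK : IsBodyWithOrigin K)
    (h0 : (0 : Sp n) ∈ interior {x | convexIndicator K x < ⊤}) : IsBodyWithInteriorOrigin K := by
  refine ⟨hK.compact, hK.convex, interior_mono (fun x hx => ?_) h0⟩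
  by_contra hne
  simp [convexIndicator, hne] at hx

end Bodies

/-! ### The two bounds for integrable functions -/

/-- The closed sublevel set `{φ ≤ t}` at a real level `t`. -/
def sublevel (φ : Sp n → ℝ≥0∞) (t : ℝ) : Set (Sp n) := {x | φ x ≤ ENNReal.ofReal t}

lemma sublevel_mono (φ : Sp n → ℝ≥0∞) : Monotone (sublevel φ) :=
  fun _ _ h _ hx => le_trans hx (ENNReal.ofReal_le_ofReal h)

lemma volume_smul_set {c : ℝ} (hc : 0 ≤ c) (A : Set (Sp n)) :
    volume (c • A) = ENNReal.ofReal (c ^ n) * volume A := by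
  rw [Measure.addHaar_smul, abs_of_nonneg (by positivity), finrank_euclideanSpace_fin]

section Functions

variable {φ : Sp n → ℝ≥0∞}

lemma IsGeometricConvex.sublevel_scaledGaugeTransform (hφ : IsGeometricConvex φ) {α s : ℝ}
    (hα : 0 < α) (hs : 0 < s) :
    sublevel (scaledGaugeTransform α φ) s = (α / s)⁻¹ • sublevel φ (α / s) := by
  ext y
  have hα' : ENNReal.ofReal α ≠ 0 := by simpa using hα
  have e : ENNReal.ofReal s = ENNReal.ofReal α * ENNReal.ofReal (s / α) := by
    rw [← ENNReal.ofReal_mul hα.le, mul_div_cancel₀ _ hα.ne']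
  rw [mem_smul_set_iff_inv_smul_mem₀ (by positivity), inv_inv]
  change ENNReal.ofReal α * gaugeTransform φ y ≤ ENNReal.ofReal s ↔ _
  rw [e, ENNReal.mul_le_mul_iff_right hα' ENNReal.ofReal_ne_top,
    hφ.gaugeTransform_le_iff (by positivity), inv_div]
  rfl

lemma IsGeometricConvex.inv_smul_sublevel_anti (hφ : IsGeometricConvex φ) {s t : ℝ} (hs : 0 < s)
    (hst : s ≤ t) : t⁻¹ • sublevel φ t ⊆ s⁻¹ • sublevel φ s := by
  have := smul_set_mono (a := s⁻¹) (hφ.smul_sublevel_subset hs hst)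
  rwa [smul_smul, div_eq_mul_inv, inv_mul_cancel_left₀ hs.ne'] at this

lemma IsGeometricConvexIntegrable.expIntegral_eq (hφ : IsGeometricConvexIntegrable φ) :
    expIntegral φ =
      ∫⁻ t in Ioi (0 : ℝ), ENNReal.ofReal (Real.exp (-t)) * volume (sublevel φ t) :=
  expIntegral_eq_lintegral_volume hφ.geometric.lsc.measurable

lemma IsGeometricConvexIntegrable.expIntegral_scaledGaugeTransform
    (hφ : IsGeometricConvexIntegrable φ) {α : ℝ} (hα : 0 < α) :
    expIntegral (scaledGaugeTransform α φ) =
      ∫⁻ s in Ioi (0 : ℝ), ENNReal.ofReal (Real.exp (-s)) *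
        volume ((α / s)⁻¹ • sublevel φ (α / s)) := by
  rw [expIntegral_eq_lintegral_volume]
  · refine setLIntegral_congr_fun measurableSet_Ioi fun s hs => ?_
    rw [← hφ.geometric.sublevel_scaledGaugeTransform hα hs]
    rfl
  · exact (lowerSemicontinuous_polarity _).measurable.const_mul _

/-- Sublevel sets grow, so `e^{-t} |{φ ≤ t}|` is at most the part of the layer-cake integral beyond
`t`. -/
lemma IsGeometricConvexIntegrable.volume_sublevel_ne_top (hφ : IsGeometricConvexIntegrable φ)
    (t : ℝ) : volume (sublevel φ t) ≠ ⊤ := by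
  suffices h : ∀ t, 0 ≤ t → volume (sublevel φ t) ≠ ⊤ from
    ((measure_mono (sublevel_mono φ (le_max_left t 0))).trans_lt
      (h _ (le_max_right t 0)).lt_top).ne
  intro t ht
  have h1 : ENNReal.ofReal (Real.exp (-t)) * volume (sublevel φ t) ≤ expIntegral φ := by
    rw [hφ.expIntegral_eq, ← lintegral_exp_neg_Ioi, ← lintegral_mul_const _ (by fun_prop)]
    calc _ ≤ ∫⁻ s in Ioi t, ENNReal.ofReal (Real.exp (-s)) * volume (sublevel φ s) :=
          setLIntegral_mono' measurableSet_Ioi fun s hs =>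
            mul_le_mul' le_rfl (measure_mono (sublevel_mono φ (le_of_lt hs)))
      _ ≤ _ := lintegral_mono_set (Ioi_subset_Ioi ht)
  intro htop
  rw [htop, ENNReal.mul_top (by simpa using Real.exp_pos _)] at h1
  exact absurd hφ.integral_lt_top (not_lt.2 h1)

/-- One null level makes all levels null: lower ones by inclusion, higher ones by homothety. Then `∫
e^{-φ} = 0`. -/
lemma IsGeometricConvexIntegrable.volume_sublevel_ne_zero (hφ : IsGeometricConvexIntegrable φ)
    {t : ℝ} (ht : 0 < t) : volume (sublevel φ t) ≠ 0 := by
  intro h0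
  have hzero : ∀ s, 0 < s → volume (sublevel φ s) = 0 := by
    intro s hs
    rcases le_total s t with h | h
    · exact measure_mono_null (sublevel_mono φ h) h0
    · have h1 := measure_mono_null (hφ.geometric.smul_sublevel_subset ht h) h0
      change volume ((t / s) • sublevel φ s) = 0 at h1
      rw [volume_smul_set (by positivity), mul_eq_zero] at h1
      refine h1.resolve_left ?_
      rw [ENNReal.ofReal_eq_zero, not_le]
      positivity
  have : expIntegral φ = 0 := by
    rw [hφ.expIntegral_eq, setLIntegral_congr_fun (g := fun _ => 0) measurableSet_Ioi]
    · simp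
    · intro s hs
      simp only [hzero s hs, mul_zero]
  exact hφ.integral_pos.ne' this

lemma IsGeometricConvexIntegrable.isBodyWithOrigin_sublevel (hφ : IsGeometricConvexIntegrable φ)
    {t : ℝ} (ht : 0 < t) : IsBodyWithOrigin (sublevel φ t) := by
  have hconv : Convex ℝ (sublevel φ t) := hφ.geometric.convex_sublevel _
  have hint := interior_nonempty_of_convex_of_measure_ne_zero hconv
    (hφ.volume_sublevel_ne_zero ht)
  exact ⟨Metric.isCompact_of_isClosed_isBounded (hφ.geometric.isClosed_sublevel _)
    (isBounded_of_convex_of_measure_ne_top hconv hint (hφ.volume_sublevel_ne_top t)), hconv, hint,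
    by simp [sublevel, hφ.geometric.map_zero]⟩

lemma eq_minkowski_of_sublevel (h : ∀ t, 0 < t → t⁻¹ • sublevel φ t = sublevel φ 1) :
    φ = minkowski (sublevel φ 1) := by
  have h' : ∀ t, 0 < t → t • sublevel φ 1 = sublevel φ t := fun t ht => by
    rw [← h t ht, smul_inv_smul₀ ht.ne']
  funext x
  apply le_antisymm
  · refine le_iInf₂ fun r hr => ?_
    have := hr.2
    rwa [h' r hr.1] at this
  -- The slack `ε` keeps the level positive when `φ x = 0`.
  · refine ENNReal.le_of_forall_pos_le_add fun ε hε hx => ?_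
    have e : φ x + ε = ENNReal.ofReal ((φ x).toReal + ε) := by
      rw [ENNReal.ofReal_add ENNReal.toReal_nonneg ε.coe_nonneg, ENNReal.ofReal_toReal hx.ne,
        ENNReal.ofReal_coe_nnreal]
    have hpos : 0 < (φ x).toReal + ε := add_pos_of_nonneg_of_pos ENNReal.toReal_nonneg hε
    rw [e]
    refine iInf₂_le _ ⟨hpos, ?_⟩
    rw [h' _ hpos]
    change φ x ≤ _
    rw [← e]
    exact le_self_add

lemma eq_convexIndicator_of_sublevel (h : ∀ t, 0 < t → sublevel φ t = sublevel φ 1) :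
    φ = convexIndicator (sublevel φ 1) := by
  funext x
  by_cases hx : x ∈ sublevel φ 1
  · rw [convexIndicator, if_pos hx]
    refine le_antisymm (ENNReal.le_of_forall_pos_le_add fun ε hε _ => ?_) zero_le
    rw [← h ε hε] at hx
    rw [zero_add, ← ENNReal.ofReal_coe_nnreal]
    exact hx
  · rw [convexIndicator, if_neg hx]
    by_contra hne
    have hpos : 0 < (φ x).toReal + 1 := add_pos_of_nonneg_of_pos ENNReal.toReal_nonneg one_pos
    apply hx
    rw [← h _ hpos]
    change φ x ≤ _
    rw [ENNReal.ofReal_add ENNReal.toReal_nonneg one_pos.le, ENNReal.ofReal_toReal hne]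
    exact le_self_add

theorem IsGeometricConvexIntegrable.upper_bound (hφ : IsGeometricConvexIntegrable φ)
    (hn : 1 ≤ n) {ρ : ℝ} (hρ : IsRho n ρ) {α : ℝ} (hα : ρ * ((n : ℝ) + 2) ^ 2 ≤ α) :
    n.factorial * expIntegral (scaledGaugeTransform α φ) ≤ expIntegral φ ∧
      (n.factorial * expIntegral (scaledGaugeTransform α φ) = expIntegral φ ↔
        ∃ K : Set (Sp n), IsBodyWithOrigin K ∧ φ = minkowski K) := by
  have hα0 : 0 < α := lt_of_lt_of_le (by have := hρ.1.1; positivity) hα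
  set g : ℝ → ℝ≥0∞ := fun t => volume (t⁻¹ • sublevel φ t) with hg
  have hganti : AntitoneOn g (Ioi 0) := fun s hs t _ hst =>
    measure_mono (hφ.geometric.inv_smul_sublevel_anti hs hst)
  have hgv : ∀ t, 0 < t → g t = ENNReal.ofReal (t⁻¹ ^ n) * volume (sublevel φ t) := fun t ht =>
    volume_smul_set (inv_nonneg.2 ht.le) _
  have hgtop : ∀ t, 0 < t → g t ≠ ⊤ := fun t ht => by
    rw [hgv t ht]
    exact ENNReal.mul_ne_top ENNReal.ofReal_ne_top (hφ.volume_sublevel_ne_top t)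
  have hE : ∫⁻ t in Ioi (0 : ℝ), ENNReal.ofReal (Real.exp (-t) * t ^ n) * g t = expIntegral φ := by
    rw [hφ.expIntegral_eq]
    refine setLIntegral_congr_fun measurableSet_Ioi fun t ht => ?_
    have ht0 : (0 : ℝ) < t := ht
    rw [hgv t ht, ← mul_assoc, ← ENNReal.ofReal_mul (by positivity), mul_assoc, ← mul_pow,
      mul_inv_cancel₀ ht0.ne', one_pow, mul_one]
  have hdom := domination n hn hρ hα hganti hgtop
  rw [hE, ← hφ.expIntegral_scaledGaugeTransform hα0] at hdom
  refine ⟨hdom.1, (hdom.2 hφ.integral_lt_top.ne).trans ⟨fun h => ?_, ?_⟩⟩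
  · have hg1 : g 1 = volume (sublevel φ 1) := by simp [hg]
    refine ⟨_, hφ.isBodyWithOrigin_sublevel one_pos, eq_minkowski_of_sublevel fun t ht => ?_⟩
    have hconv : Convex ℝ (sublevel φ 1) := hφ.geometric.convex_sublevel _
    have hclosed : ∀ t, IsClosed (sublevel φ t) := fun t => hφ.geometric.isClosed_sublevel _
    have hconvt : Convex ℝ (t⁻¹ • sublevel φ t) := (hφ.geometric.convex_sublevel _).smul _
    have h0 := hφ.volume_sublevel_ne_zero one_pos
    have htop := hφ.volume_sublevel_ne_top 1
    have heq : volume (t⁻¹ • sublevel φ t) = volume (sublevel φ 1) := (h t ht).trans hg1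
    rcases le_total 1 t with h1 | h1
    · have hsub := hφ.geometric.inv_smul_sublevel_anti one_pos h1
      rw [inv_one, one_smul] at hsub
      exact eq_of_subset_of_measure_eq ((hclosed t).smul₀ _) hconv hsub h0 htop heq
    · have hsub := hφ.geometric.inv_smul_sublevel_anti ht h1
      rw [inv_one, one_smul] at hsub
      exact (eq_of_subset_of_measure_eq (hclosed 1) hconvt hsub (heq ▸ h0) (heq ▸ htop)
        heq.symm).symm
  · rintro ⟨K, hK, rfl⟩
    have hs : ∀ t, 0 < t → t⁻¹ • sublevel (minkowski K) t = K := by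
      intro t ht
      have : sublevel (minkowski K) t = t • K := by
        ext x; exact hK.minkowski_le_iff ht x
      rw [this, inv_smul_smul₀ ht.ne']
    intro t ht
    simp only [hg]
    rw [hs t ht, hs 1 one_pos]

theorem IsGeometricConvexIntegrable.lower_bound (hφ : IsGeometricConvexIntegrable φ)
    (hn : 1 ≤ n) {ρ : ℝ} (hρ : IsRho n ρ) {α : ℝ} (hα : ρ * ((n : ℝ) + 2) ^ 2 ≤ α) :
    n.factorial * expIntegral φ ≤
        expIntegral (scaledGaugeTransform α φ) * ENNReal.ofReal α ^ n ∧
      (n.factorial * expIntegral φ = expIntegral (scaledGaugeTransform α φ) * ENNReal.ofReal α ^ n ↔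
        ∃ K : Set (Sp n), IsBodyWithOrigin K ∧ φ = convexIndicator K) := by
  have hα0 : 0 < α := lt_of_lt_of_le (by have := hρ.1.1; positivity) hα
  set g : ℝ → ℝ≥0∞ := fun s => volume (sublevel φ (α / s)) with hg
  have hganti : AntitoneOn g (Ioi 0) := fun s hs t _ hst =>
    measure_mono (sublevel_mono φ (div_le_div_of_nonneg_left hα0.le hs hst))
  have hgtop : ∀ t, 0 < t → g t ≠ ⊤ := fun t _ => hφ.volume_sublevel_ne_top _
  have hinv : ∀ t, 0 < t → α / (α / t) = t := fun t ht => by field_simp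
  have hE : ∫⁻ s in Ioi (0 : ℝ), ENNReal.ofReal (Real.exp (-s)) * g (α / s) = expIntegral φ := by
    rw [hφ.expIntegral_eq]
    refine setLIntegral_congr_fun measurableSet_Ioi fun t ht => ?_
    simp only [hg]
    rw [hinv t ht]
  have hψ : ∫⁻ t in Ioi (0 : ℝ), ENNReal.ofReal (Real.exp (-t) * t ^ n) * g t =
      expIntegral (scaledGaugeTransform α φ) * ENNReal.ofReal α ^ n := by
    rw [hφ.expIntegral_scaledGaugeTransform hα0,
      ← lintegral_mul_const' _ _ (ENNReal.pow_ne_top ENNReal.ofReal_ne_top)]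
    refine setLIntegral_congr_fun measurableSet_Ioi fun t ht => ?_
    have ht0 : (0 : ℝ) < t := ht
    simp only [hg]
    have e : Real.exp (-t) * t ^ n = Real.exp (-t) * ((α / t)⁻¹ ^ n * α ^ n) := by
      rw [inv_div, div_pow, div_mul_cancel₀ _ (by positivity)]
    rw [volume_smul_set (by positivity), e, ENNReal.ofReal_mul (by positivity),
      ENNReal.ofReal_mul (by positivity), ENNReal.ofReal_pow hα0.le]
    ring
  have hdom := domination n hn hρ hα hganti hgtop
  rw [hE, hψ] at hdom
  -- The equality case of `domination` needs a finite right-hand side, which the upper bound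
  -- supplies.
  have hψtop : expIntegral (scaledGaugeTransform α φ) ≠ ⊤ := by
    intro htop
    have h1 := (hφ.upper_bound hn hρ hα).1
    rw [htop, ENNReal.mul_top (by simpa using n.factorial_ne_zero)] at h1
    exact absurd hφ.integral_lt_top (not_lt.2 h1)
  refine ⟨hdom.1, (hdom.2 (ENNReal.mul_ne_top hψtop
    (ENNReal.pow_ne_top ENNReal.ofReal_ne_top))).trans ⟨fun h => ?_, ?_⟩⟩
  · refine ⟨_, hφ.isBodyWithOrigin_sublevel one_pos, eq_convexIndicator_of_sublevel fun t ht => ?_⟩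
    have hvol : ∀ t, 0 < t → volume (sublevel φ t) = g 1 := fun t ht => by
      rw [← h (α / t) (div_pos hα0 ht)]
      simp only [hg]
      rw [hinv t ht]
    have heq : volume (sublevel φ t) = volume (sublevel φ 1) :=
      (hvol t ht).trans (hvol 1 one_pos).symm
    have hstep : ∀ r s : ℝ, 0 < s → r ≤ s → volume (sublevel φ r) = volume (sublevel φ s) →
        sublevel φ r = sublevel φ s := fun r s hs hrs hv =>
      eq_of_subset_of_measure_eq (hφ.geometric.isClosed_sublevel _)
        (hφ.geometric.convex_sublevel _) (sublevel_mono φ hrs) (hφ.volume_sublevel_ne_zero hs)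
        (hφ.volume_sublevel_ne_top s) hv
    rcases le_total t 1 with h1 | h1
    · exact hstep t 1 one_pos h1 heq
    · exact (hstep 1 t ht h1 heq.symm).symm
  · rintro ⟨K, -, rfl⟩ t -
    have hs : ∀ t, sublevel (convexIndicator K) t = K := by
      intro t
      ext x
      by_cases hx : x ∈ K <;> simp [sublevel, convexIndicator, hx]
    simp only [hg, hs]

end Functions

lemma ennreal_div_le_div_iff {a b c d : ℝ≥0∞} (hb : b ≠ 0) (hb' : b ≠ ⊤) (hd : d ≠ 0)
    (hd' : d ≠ ⊤) : a / b ≤ c / d ↔ a * d ≤ c * b := by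
  rw [ENNReal.div_le_iff hb hb', ENNReal.mul_comm_div, ← mul_div_assoc,
    ENNReal.le_div_iff_mul_le (Or.inl hd) (Or.inl hd')]

end ScaledGauge

end

/-! ### The theorem in terms of the Santaló ratio -/

theorem theorem1p1 (n : ℕ) (hn : 1 ≤ n) :
    (∃! ρ : ℝ, ScaledGauge.IsRho n ρ) ∧
    ∀ ρ : ℝ, ScaledGauge.IsRho n ρ →
    ∀ α : ℝ, ρ * ((n : ℝ) + 2) ^ 2 ≤ α →
    ∀ φ : ScaledGauge.Sp n → ℝ≥0∞, ScaledGauge.IsGeometricConvexIntegrable φ →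
      -- the upper bound and its equality cases
      (ScaledGauge.santaloRatio α φ ≤ 1 / (n.factorial : ℝ≥0∞) ∧
        (ScaledGauge.santaloRatio α φ = 1 / (n.factorial : ℝ≥0∞) ↔
          ∃ K : Set (ScaledGauge.Sp n), ScaledGauge.IsBodyWithOrigin K ∧
            φ = ScaledGauge.minkowski K) ∧
        ((0 : ScaledGauge.Sp n) ∈ interior {x | φ x < ⊤} →
          (ScaledGauge.santaloRatio α φ = 1 / (n.factorial : ℝ≥0∞) ↔
            ∃ K : Set (ScaledGauge.Sp n), ScaledGauge.IsBodyWithInteriorOrigin K ∧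
              φ = ScaledGauge.minkowski K))) ∧
      -- the lower bound and its equality cases
      ((n.factorial : ℝ≥0∞) / ENNReal.ofReal α ^ n ≤ ScaledGauge.santaloRatio α φ ∧
        (ScaledGauge.santaloRatio α φ = (n.factorial : ℝ≥0∞) / ENNReal.ofReal α ^ n ↔
          ∃ K : Set (ScaledGauge.Sp n), ScaledGauge.IsBodyWithOrigin K ∧
            φ = ScaledGauge.gaugeTransform (ScaledGauge.minkowski K) ∧
            ScaledGauge.gaugeTransform (ScaledGauge.minkowski K) =
              ScaledGauge.convexIndicator K) ∧
        ((0 : ScaledGauge.Sp n) ∈ interior {x | φ x < ⊤} →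
          (ScaledGauge.santaloRatio α φ = (n.factorial : ℝ≥0∞) / ENNReal.ofReal α ^ n ↔
            ∃ K : Set (ScaledGauge.Sp n), ScaledGauge.IsBodyWithInteriorOrigin K ∧
              φ = ScaledGauge.gaugeTransform (ScaledGauge.minkowski K) ∧
              ScaledGauge.gaugeTransform (ScaledGauge.minkowski K) =
                ScaledGauge.convexIndicator K))) := by
  refine ⟨ScaledGauge.existsUnique_isRho n hn, fun ρ hρ α hα φ hφ => ?_⟩
  have hα0 : 0 < α := lt_of_lt_of_le (by have := hρ.1.1; positivity) hα
  have hE0 := hφ.integral_pos.ne'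
  have hEtop := hφ.integral_lt_top.ne
  have hf0 : (n.factorial : ℝ≥0∞) ≠ 0 := by simpa using n.factorial_ne_zero
  have hftop : (n.factorial : ℝ≥0∞) ≠ ⊤ := ENNReal.natCast_ne_top _
  have hα0' : ENNReal.ofReal α ^ n ≠ 0 := pow_ne_zero _ (by simpa using hα0)
  have hαtop : ENNReal.ofReal α ^ n ≠ ⊤ := ENNReal.pow_ne_top ENNReal.ofReal_ne_top
  obtain ⟨hU, hUeq⟩ := hφ.upper_bound hn hρ hα
  obtain ⟨hL, hLeq⟩ := hφ.lower_bound hn hρ hα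
  have hupper : ScaledGauge.santaloRatio α φ = 1 / (n.factorial : ℝ≥0∞) ↔
      ∃ K : Set (ScaledGauge.Sp n), ScaledGauge.IsBodyWithOrigin K ∧
        φ = ScaledGauge.minkowski K := by
    rw [← hUeq, ScaledGauge.santaloRatio, ENNReal.div_eq_div_iff hf0 hftop hE0 hEtop, mul_one]
  have hlower : ScaledGauge.santaloRatio α φ = (n.factorial : ℝ≥0∞) / ENNReal.ofReal α ^ n ↔
      ∃ K : Set (ScaledGauge.Sp n), ScaledGauge.IsBodyWithOrigin K ∧
        φ = ScaledGauge.convexIndicator K := by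
    rw [← hLeq, ScaledGauge.santaloRatio, ENNReal.div_eq_div_iff hα0' hαtop hE0 hEtop,
      mul_comm (ENNReal.ofReal α ^ n), mul_comm (ScaledGauge.expIntegral φ), eq_comm]
  refine ⟨⟨?_, hupper, fun h0 => hupper.trans ⟨?_, ?_⟩⟩, ?_, hlower.trans ⟨?_, ?_⟩,
    fun h0 => hlower.trans ⟨?_, ?_⟩⟩
  · rw [ScaledGauge.santaloRatio, ScaledGauge.ennreal_div_le_div_iff hE0 hEtop hf0 hftop, one_mul,
      mul_comm]
    exact hU
  · rintro ⟨K, hK, rfl⟩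
    exact ⟨K, hK.interiorOrigin_of_minkowski h0, rfl⟩
  · rintro ⟨K, hK, rfl⟩
    exact ⟨K, hK.isBodyWithOrigin, rfl⟩
  · rw [ScaledGauge.santaloRatio, ScaledGauge.ennreal_div_le_div_iff hα0' hαtop hE0 hEtop]
    exact hL
  · rintro ⟨K, hK, rfl⟩
    exact ⟨K, hK, hK.gaugeTransform_minkowski.symm, hK.gaugeTransform_minkowski⟩
  · rintro ⟨K, hK, h1, h2⟩
    exact ⟨K, hK, h1.trans h2⟩
  · rintro ⟨K, hK, rfl⟩
    exact ⟨K, hK.interiorOrigin_of_convexIndicator h0,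
      hK.gaugeTransform_minkowski.symm, hK.gaugeTransform_minkowski⟩
  · rintro ⟨K, hK, h1, h2⟩
    exact ⟨K, hK.isBodyWithOrigin, h1.trans h2⟩
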